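/- Let $\mathbf{P}_+$ be the set of continuous, bounded, positive-definite functions $\mathcal F:\mathbb R\to\mathbb C$ with $\mathcal F(0)=1$ (equivalently, the characteristic functions of real random variables). Let $\mathbf{D}$ (the van Dantzig class) be the set of all $\mathcal F\in\mathbf{P}_+$ that extend meromorphically to a neighbourhood of $\mathbb R\cup i\mathbb R$ and for which the reciprocal $V\mathcal F(t)=1/\mathcal F(it)$, $t\in\mathbb R$ (computed with this extension, and understood as $0$ at the poles of $\mathcal F$ on the imaginary axis), again belongs to $\mathbf{P}_+$. Let $\mathbf{D}_L$ (the Lukacs class) be the set of all $\mathcal F\in\mathbf{P}_+$ that are restrictions to $\mathbb R$ of an even entire function $\varphi$ with $\varphi(0)=1$ in the Laguerre–Pólya class, i.e. such that $\varphi$ is the locally uniform limit on $\mathbb C$ of a sequence of polynomials with real coefficients and only real zeros. Theorem. $\mathbf{D}$ and $\mathbf{D}_L$ are both closed under locally uniform convergence on $\mathbb R$: if $\mathcal F_n\in\mathbf{D}$ for all $n$ (respectively $\mathcal F_n\in\mathbf{D}_L$ for all $n$) and $\mathcal F_n\to\mathcal F$ uniformly on compact subsets of $\mathbb R$, then $\mathcal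 F\in\mathbf{D}$ (respectively $\mathcal F\in\mathbf{D}_L$). -/

import Mathlib

open Filter
open scoped ComplexOrder

namespace VanDantzig

/-- The set `P₊` of continuous bounded positive-definite functions on `ℝ`, normalized to be `1`
at the origin. Positive-definiteness: all the matrices `(F (t j - t k))` are positive semidefinite
(Hermitian, with nonnegative quadratic form). -/
def PPlus : Set (ℝ → ℂ) :=
  {F | Continuous F ∧ (∃ C : ℝ, ∀ t, ‖F t‖ ≤ C) ∧
    (∀ (n : ℕ) (t : Fin n → ℝ),
      (Matrix.of fun j k : Fin n => F (t j - t k)).PosSemidef) ∧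
    F 0 = 1}

/-- The union of the real and the imaginary axis. -/
def axes : Set ℂ := {z | z.im = 0 ∨ z.re = 0}

/-- `f` extends `F : ℝ → ℂ` to a function that is meromorphic on a neighbourhood of the union of
the two axes (meromorphy at a point is a condition on a neighbourhood of that point). As the axes
form a connected set, `f` is determined on the axes by `F`. "Normal form" fixes the values of `f`:
they are the analytic ones away from the poles, and `f z = 0` when `z` is a pole. -/
def IsExtension (F : ℝ → ℂ) (f : ℂ → ℂ) : Prop :=
  MeromorphicNFOn f axes ∧ ∀ t : ℝ, f (t : ℂ) = F t

/-- The reciprocal `t ↦ 1 / F (i t)`, written with the extension `f` of `F`.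
At a pole of `f` the value is `0⁻¹ = 0`, which is the value of `1 / f` there. At a zero of `f`
on the imaginary axis, `1 / f` is unbounded nearby, so that `reciprocal f` is not in `PPlus`. -/
noncomputable def reciprocal (f : ℂ → ℂ) : ℝ → ℂ := fun t => (f ((t : ℂ) * Complex.I))⁻¹

/-- The van Dantzig class `D`: the `F ∈ P₊` such that `V F : t ↦ 1 / F (i t)` is in `P₊`. -/
def classD : Set (ℝ → ℂ) :=
  {F | F ∈ PPlus ∧ ∃ f : ℂ → ℂ, IsExtension F f ∧ reciprocal f ∈ PPlus}

/-- The Laguerre-Pólya class: entire functions that are locally uniform limits (on `ℂ`) of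
polynomials with real coefficients and real zeros only. -/
def LaguerrePolya : Set (ℂ → ℂ) :=
  {φ | Differentiable ℂ φ ∧ ∃ p : ℕ → Polynomial ℝ,
    (∀ n, ∀ z : ℂ, Polynomial.aeval z (p n) = 0 → z.im = 0) ∧
    TendstoLocallyUniformly (fun n z => Polynomial.aeval z (p n)) φ atTop}

/-- Even functions of the Laguerre-Pólya class with value `1` at the origin. -/
def EvenLaguerrePolya : Set (ℂ → ℂ) :=
  {φ | φ ∈ LaguerrePolya ∧ (∀ z, φ (-z) = φ z) ∧ φ 0 = 1}

/-- The Lukacs class `D_L`: the elements of `P₊` that are restrictions to `ℝ` of normalized even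
Laguerre-Pólya functions. -/
def classDL : Set (ℝ → ℂ) :=
  {F | F ∈ PPlus ∧ ∃ φ ∈ EvenLaguerrePolya, ∀ t : ℝ, F t = φ (t : ℂ)}

/-- A set of functions on `ℝ` is closed under locally uniform convergence (on `ℝ`). -/
def ClosedUnderLocallyUniformConvergence (S : Set (ℝ → ℂ)) : Prop :=
  ∀ (F : ℕ → ℝ → ℂ) (G : ℝ → ℂ), (∀ n, F n ∈ S) →
    TendstoLocallyUniformly F G atTop → G ∈ S

end VanDantzig

/-! The conditions defining `PPlus` pass to the limit `G`, using `|F| ≤ 1` on the class and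
continuity under locally uniform limits. Since `G 0 = 1`, there is `δ > 0` with `|F n| ≥ 1/2` on
`[-δ, δ]` for large `n`. In both classes this local lower bound yields a complex upper bound, hence
a normal family whose limits extend `G`. Limits along an ultrafilter suffice, since only existence
of the extension is needed.

Lukacs class: for a polynomial with real nonzero roots `r`, `|p(z) p(-z)| = |p(0)|² ∏ |1 - z²/r²| ≤
|p(0)|² exp(|z|² ∑ r⁻²)`. If no root lies in `[-δ, δ]`, the same product at `z = δ` is at most
`|p(0)|² exp(-δ² ∑ r⁻²)`, so a lower bound at `±δ` bounds `∑ r⁻²`. By evenness this bounds `φ(z)²`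
(`norm_sq_le_of_mem_evenLaguerrePolya`).

Van Dantzig class: by Bochner's theorem, members of `PPlus` are characteristic functions. If one is
analytic along a segment of the imaginary axis, nonnegativity of the even moments gives exponential
moments, hence an extension to a strip controlled by the values on that segment
(`exists_strip_extension`). For `V F_n` these values are `1 / F_n(-y)`, at most `2` in modulus when
`|y| < δ`. Thus `V F_n` has a limit `g` on a strip, with `g(0) = 1`. So `|V F_n| ≥ 1/2` near `0`,
and the argument with the roles exchanged gives a limit `h` of `F_n` on a strip. The relation `h(iy)
g(y) = 1` glues `h` to `1 / g(-iz)`, which extends `G` along both axes (`mem_classD_of_strip`). -/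

open Topology Metric MeasureTheory ProbabilityTheory

/-! ### Normal families along an ultrafilter -/

/-- Montel's theorem along an ultrafilter: a locally bounded family of holomorphic functions
converges locally uniformly along every ultrafilter. -/
theorem exists_tendstoLocallyUniformlyOn_ultrafilter {ι : Type*} (U : Ultrafilter ι)
    {S : Set ℂ} (hS : IsOpen S) {f : ι → ℂ → ℂ}
    (hf : ∀ᶠ i in (U : Filter ι), DifferentiableOn ℂ (f i) S)
    (hb : ∀ z ∈ S, ∃ V ∈ 𝓝 z, ∃ M : ℝ, ∀ᶠ i in (U : Filter ι), ∀ w ∈ V, ‖f i w‖ ≤ M) :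
    ∃ g : ℂ → ℂ, DifferentiableOn ℂ g S ∧ TendstoLocallyUniformlyOn f g U S := by
  have hlim : ∀ z ∈ S, ∃ l, Tendsto (fun i => f i z) U (𝓝 l) := by
    intro z hz
    obtain ⟨V, hV, M, hM⟩ := hb z hz
    have : ∀ᶠ i in (U : Filter ι), f i z ∈ closedBall (0 : ℂ) M := by
      filter_upwards [hM] with i hi
      simpa using hi z (mem_of_mem_nhds hV)
    obtain ⟨l, -, hl⟩ := (isCompact_closedBall (0 : ℂ) M).ultrafilter_le_nhds'
      (U.map fun i => f i z) this
    exact ⟨l, hl⟩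
  classical
  choose! g hg using hlim
  have hloc : TendstoLocallyUniformlyOn f g U S := by
    rw [Metric.tendstoLocallyUniformlyOn_iff]
    intro ε hε z hz
    obtain ⟨V, hV, M, hM⟩ := hb z hz
    obtain ⟨r, hr, hrV⟩ := Metric.mem_nhds_iff.1 (inter_mem hV (hS.mem_nhds hz))
    set K : ℝ := 2 * max M 1 / r with hK
    have hKpos : 0 < K := by positivity
    -- The Schwarz lemma turns the local bound into a Lipschitz bound at `z` uniform in `i`; this
    -- equicontinuity upgrades pointwise to locally uniform convergence.
    have hlip : ∀ᶠ i in (U : Filter ι), ∀ w ∈ ball z r, ‖f i w - f i z‖ ≤ K * ‖w - z‖ := by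
      filter_upwards [hf, hM] with i hi hMi w hw
      have hmaps : Set.MapsTo (f i) (ball z r) (closedBall (f i z) (2 * max M 1)) := by
        intro y hy
        rw [mem_closedBall, dist_eq_norm]
        calc ‖f i y - f i z‖ ≤ ‖f i y‖ + ‖f i z‖ := norm_sub_le _ _
          _ ≤ M + M := add_le_add (hMi _ (hrV hy).1) (hMi _ (hrV (mem_ball_self hr)).1)
          _ ≤ 2 * max M 1 := by linarith [le_max_left M 1]
      have := Complex.dist_le_div_mul_dist_of_mapsTo_ball (hi.mono fun y hy => (hrV hy).2) hmaps hw
      simpa [dist_eq_norm] using this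
    set ρ : ℝ := min r (ε / (4 * K)) with hρ
    have hρpos : 0 < ρ := by positivity
    have hsmall : ∀ w ∈ ball z ρ, K * ‖w - z‖ ≤ ε / 4 := by
      intro w hw
      have h1 : ‖w - z‖ ≤ ε / (4 * K) :=
        (mem_ball_iff_norm.1 hw).le.trans (min_le_right _ _)
      calc K * ‖w - z‖ ≤ K * (ε / (4 * K)) := by gcongr
        _ = ε / 4 := by field_simp
    refine ⟨ball z ρ ∩ S,
      Set.inter_comm S _ ▸ inter_mem_nhdsWithin S (ball_mem_nhds z hρpos), ?_⟩
    have hz' := (Metric.tendsto_nhds.1 (hg z hz)) (ε / 4) (by positivity)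
    filter_upwards [hlip, hz'] with i hi hiz w hw
    have hwr : w ∈ ball z r := ball_subset_ball (min_le_left _ _) hw.1
    have h1 : ‖g w - g z‖ ≤ ε / 4 := by
      refine le_of_tendsto (((hg w hw.2).sub (hg z hz)).norm) ?_
      filter_upwards [hlip] with j hj
      exact (hj w hwr).trans (hsmall w hw.1)
    have h2 : ‖f i w - f i z‖ ≤ ε / 4 := (hi w hwr).trans (hsmall w hw.1)
    rw [dist_eq_norm] at hiz ⊢
    have h3 : g w - f i w = (g w - g z) - (f i w - f i z) - (f i z - g z) := by ring
    rw [h3]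
    calc ‖(g w - g z) - (f i w - f i z) - (f i z - g z)‖
        ≤ ‖g w - g z‖ + ‖f i w - f i z‖ + ‖f i z - g z‖ :=
          (norm_sub_le _ _).trans (by gcongr; exact norm_sub_le _ _)
      _ < ε := by linarith
  exact ⟨g, hloc.differentiableOn hf hS, hloc⟩

/-! ### Limits of normalized positive-definite functions -/

namespace VanDantzig

theorem PPlus_of_tendsto {ι : Type*} {l : Filter ι} [l.NeBot] {F : ι → ℝ → ℂ} {G : ℝ → ℂ}
    (hF : ∀ i, F i ∈ PPlus) (hlim : ∀ t, Tendsto (fun i => F i t) l (𝓝 (G t)))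
    (hG : Continuous G) (hbd : ∃ C : ℝ, ∀ t, ‖G t‖ ≤ C) : G ∈ PPlus := by
  refine ⟨hG, hbd, fun n t => ?_, ?_⟩
  · have hM : Tendsto (fun i => (Matrix.of fun j k : Fin n => F i (t j - t k))) l
        (𝓝 (Matrix.of fun j k : Fin n => G (t j - t k))) := by
      refine tendsto_pi_nhds.2 fun j => tendsto_pi_nhds.2 fun k => ?_
      exact hlim _
    refine Matrix.PosSemidef.of_dotProduct_mulVec_nonneg ?_ fun x => ?_
    · refine tendsto_nhds_unique (f := fun i => (Matrix.of fun j k : Fin n => F i (t j - t k)))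
        (hM.star.congr fun i => ?_) hM
      exact ((hF i).2.2.1 n t).1
    · refine ge_of_tendsto (x := l) (f := fun i => dotProduct (star x)
          ((Matrix.of fun j k : Fin n => F i (t j - t k)).mulVec x)) ?_
        (Eventually.of_forall fun i => ((hF i).2.2.1 n t).dotProduct_mulVec_nonneg x)
      have : Continuous fun A : Matrix (Fin n) (Fin n) ℂ => dotProduct (star x) (A.mulVec x) := by
        fun_prop
      exact (this.tendsto _).comp hM
  · have h := hlim 0
    simp only [fun i => (hF i).2.2.2] at h
    exact (tendsto_nhds_unique h tendsto_const_nhds)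

/-- The positive semidefinite matrix at the two points `t, 0` has determinant `1 - |F t|²`. -/
theorem PPlus_norm_le_one {F : ℝ → ℂ} (hF : F ∈ PPlus) (t : ℝ) : ‖F t‖ ≤ 1 := by
  have h := hF.2.2.1 2 ![t, 0]
  have hdet := h.det_nonneg
  have hherm := h.1.apply 0 1
  simp only [Matrix.of_apply, Matrix.cons_val_zero, Matrix.cons_val_one, sub_zero, zero_sub] at hherm
  rw [Matrix.det_fin_two] at hdet
  simp only [Matrix.of_apply, Matrix.cons_val_zero, Matrix.cons_val_one, sub_zero, sub_self,
    zero_sub, hF.2.2.2] at hdet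
  have h2 : F t * F (-t) = ((‖F t‖ ^ 2 : ℝ) : ℂ) := by
    rw [← hherm, norm_star, mul_comm, Complex.star_def, Complex.mul_conj']
    push_cast
    rfl
  rw [h2] at hdet
  have : (0 : ℝ) ≤ 1 * 1 - ‖F t‖ ^ 2 := by exact_mod_cast hdet
  nlinarith [norm_nonneg (F t)]

theorem PPlus_of_tendstoLocallyUniformly {F : ℕ → ℝ → ℂ} {G : ℝ → ℂ}
    (hF : ∀ n, F n ∈ PPlus) (hlim : TendstoLocallyUniformly F G atTop) : G ∈ PPlus := by
  have hpt : ∀ t, Tendsto (fun n => F n t) atTop (𝓝 (G t)) := fun t =>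
    (tendstoLocallyUniformlyOn_univ.2 hlim).tendsto_at (Set.mem_univ t)
  exact PPlus_of_tendsto hF hpt (hlim.continuous (Frequently.of_forall fun n => (hF n).1))
    ⟨1, fun t => le_of_tendsto (hpt t).norm
      (Eventually.of_forall fun n => PPlus_norm_le_one (hF n) t)⟩

/-- Functions converging locally uniformly to an element of `PPlus` are eventually bounded away
from zero on a fixed neighbourhood of the origin. -/
theorem exists_eventually_half_le_norm {ι : Type*} {l : Filter ι} {F : ι → ℝ → ℂ} {G : ℝ → ℂ}
    (hG : G ∈ PPlus) (hlim : ∀ ε > 0, ∃ t ∈ 𝓝 (0 : ℝ), ∀ᶠ n in l, ∀ y ∈ t, dist (G y) (F n y) < ε) :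
    ∃ δ > 0, ∀ᶠ n in l, ∀ t : ℝ, |t| ≤ δ → 1 / 2 ≤ ‖F n t‖ := by
  obtain ⟨V, hV, hVn⟩ := hlim (1 / 4) (by norm_num)
  have hc : ∀ᶠ t in 𝓝 (0 : ℝ), dist (G t) 1 < 1 / 4 := by
    have := (hG.1.tendsto 0)
    rw [hG.2.2.2] at this
    exact Metric.tendsto_nhds.1 this _ (by norm_num)
  obtain ⟨r, hr, hrV⟩ := Metric.mem_nhds_iff.1 (inter_mem hV hc)
  refine ⟨r / 2, by positivity, ?_⟩
  filter_upwards [hVn] with n hn t ht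
  have htr : t ∈ ball (0 : ℝ) r := by
    rw [mem_ball_zero_iff, Real.norm_eq_abs]; linarith
  have h1 := hn t (hrV htr).1
  have h2 : dist (G t) 1 < 1 / 4 := (hrV htr).2
  rw [dist_eq_norm] at h1 h2
  have h3 : (1 : ℂ) = F n t + (G t - F n t) - (G t - 1) := by ring
  have h4 : ‖(1 : ℂ)‖ ≤ ‖F n t‖ + ‖G t - F n t‖ + ‖G t - 1‖ := by
    conv_lhs => rw [h3]
    exact (norm_sub_le _ _).trans (by gcongr; exact norm_add_le _ _)
  rw [norm_one] at h4
  linarith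

/-! ### Growth of Laguerre–Pólya functions and the Lukacs class -/

/-- Pairing `z` with `-z` cancels the linear terms: each factor is `|r² - z²| ≤ |r|² (1 +
|z|²/|r|²)`, and `1 + x ≤ exp x`. -/
theorem prod_norm_sub_mul_le (s : Multiset ℂ) (hs : ∀ r ∈ s, r ≠ 0) (z : ℂ) :
    (s.map fun r => ‖z - r‖ * ‖-z - r‖).prod ≤
      (s.map fun r => ‖r‖ ^ 2).prod * Real.exp (‖z‖ ^ 2 * (s.map fun r => (‖r‖ ^ 2)⁻¹).sum) := by
  induction s using Multiset.induction_on with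
  | empty => simp
  | cons r s ih =>
    have ih' := ih fun x hx => hs x (Multiset.mem_cons_of_mem hx)
    have hr : 0 < ‖r‖ := norm_pos_iff.2 (hs r (Multiset.mem_cons_self r s))
    simp only [Multiset.map_cons, Multiset.prod_cons, Multiset.sum_cons, mul_add, Real.exp_add]
    have h1 : ‖z - r‖ * ‖-z - r‖ ≤ ‖r‖ ^ 2 * Real.exp (‖z‖ ^ 2 * (‖r‖ ^ 2)⁻¹) := by
      have h2 : ‖z - r‖ * ‖-z - r‖ ≤ ‖r‖ ^ 2 + ‖z‖ ^ 2 := by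
        rw [← norm_mul, ← norm_pow, ← norm_pow]
        have : (z - r) * (-z - r) = r ^ 2 - z ^ 2 := by ring
        rw [this]
        exact norm_sub_le _ _
      have h3 := Real.add_one_le_exp (‖z‖ ^ 2 * (‖r‖ ^ 2)⁻¹)
      calc _ ≤ ‖r‖ ^ 2 + ‖z‖ ^ 2 := h2
        _ = ‖r‖ ^ 2 * (‖z‖ ^ 2 * (‖r‖ ^ 2)⁻¹ + 1) := by field_simp; ring
        _ ≤ _ := by gcongr
    calc _ ≤ (‖r‖ ^ 2 * Real.exp (‖z‖ ^ 2 * (‖r‖ ^ 2)⁻¹)) * ((s.map fun r => ‖r‖ ^ 2).prod *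
          Real.exp (‖z‖ ^ 2 * (s.map fun r => (‖r‖ ^ 2)⁻¹).sum)) := by
          refine mul_le_mul h1 ih' ?_ (by positivity)
          refine Multiset.prod_nonneg fun a ha => ?_
          obtain ⟨x, -, rfl⟩ := Multiset.mem_map.1 ha
          positivity
      _ = _ := by ring

/-- For real `r` with `|δ| ≤ |r|` each factor is exactly `r² (1 - δ²/r²)`, and `1 - x ≤ exp (-x)`.
The same sum `∑ |r|⁻²` now appears with a negative sign, so it can be bounded from above. -/
theorem prod_norm_sub_mul_le_of_real (s : Multiset ℂ) {δ : ℝ}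
    (hs : ∀ r ∈ s, r ≠ 0 ∧ r.im = 0 ∧ |δ| ≤ |r.re|) :
    (s.map fun r => ‖(δ : ℂ) - r‖ * ‖-(δ : ℂ) - r‖).prod ≤
      (s.map fun r => ‖r‖ ^ 2).prod * Real.exp (-(δ ^ 2 * (s.map fun r => (‖r‖ ^ 2)⁻¹).sum)) := by
  induction s using Multiset.induction_on with
  | empty => simp
  | cons r s ih =>
    have ih' := ih fun x hx => hs x (Multiset.mem_cons_of_mem hx)
    obtain ⟨hr0, him, hre⟩ := hs r (Multiset.mem_cons_self r s)
    have hr : 0 < ‖r‖ := norm_pos_iff.2 hr0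
    simp only [Multiset.map_cons, Multiset.prod_cons, Multiset.sum_cons, mul_add, Real.exp_add,
      neg_add]
    have h1 : ‖(δ : ℂ) - r‖ * ‖-(δ : ℂ) - r‖ ≤ ‖r‖ ^ 2 * Real.exp (-(δ ^ 2 * (‖r‖ ^ 2)⁻¹)) := by
      have hrr : r = (r.re : ℂ) := Complex.ext (by simp) (by simp [him])
      have h2 : ‖(δ : ℂ) - r‖ * ‖-(δ : ℂ) - r‖ = ‖r‖ ^ 2 - δ ^ 2 := by
        rw [← norm_mul, ← norm_pow]
        have : ((δ : ℂ) - r) * (-(δ : ℂ) - r) = r ^ 2 - (δ : ℂ) ^ 2 := by ring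
        rw [this, hrr]
        norm_cast
        rw [Real.norm_eq_abs, Real.norm_eq_abs, abs_sq,
          abs_of_nonneg (sub_nonneg.2 (sq_le_sq.2 hre))]
      have h3 := Real.add_one_le_exp (-(δ ^ 2 * (‖r‖ ^ 2)⁻¹))
      calc _ = ‖r‖ ^ 2 - δ ^ 2 := h2
        _ = ‖r‖ ^ 2 * (-(δ ^ 2 * (‖r‖ ^ 2)⁻¹) + 1) := by field_simp; ring
        _ ≤ _ := by gcongr
    calc _ ≤ (‖r‖ ^ 2 * Real.exp (-(δ ^ 2 * (‖r‖ ^ 2)⁻¹))) * ((s.map fun r => ‖r‖ ^ 2).prod *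
          Real.exp (-(δ ^ 2 * (s.map fun r => (‖r‖ ^ 2)⁻¹).sum))) := by
          refine mul_le_mul h1 ih' ?_ (by positivity)
          refine Multiset.prod_nonneg fun a ha => ?_
          obtain ⟨x, -, rfl⟩ := Multiset.mem_map.1 ha
          positivity
      _ = _ := by ring

/-- A growth bound for real-rooted polynomials in terms of their values on `[-δ, δ]`. -/
theorem norm_aeval_mul_aeval_neg_le {p : Polynomial ℝ}
    (hp : ∀ z : ℂ, Polynomial.aeval z p = 0 → z.im = 0) {δ L : ℝ} (hδ : 0 < δ)
    (hne : ∀ t : ℝ, |t| ≤ δ → Polynomial.aeval (t : ℂ) p ≠ 0)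
    (hL : Real.exp (-L) * ‖Polynomial.aeval (0 : ℂ) p‖ ^ 2 ≤
      ‖Polynomial.aeval (δ : ℂ) p‖ * ‖Polynomial.aeval (-δ : ℂ) p‖) (z : ℂ) :
    ‖Polynomial.aeval z p‖ * ‖Polynomial.aeval (-z) p‖ ≤
      ‖Polynomial.aeval (0 : ℂ) p‖ ^ 2 * Real.exp (L / δ ^ 2 * ‖z‖ ^ 2) := by
  set P : Polynomial ℂ := p.map (algebraMap ℝ ℂ) with hP
  have hev : ∀ w : ℂ, Polynomial.aeval w p = P.eval w := fun w => by
    rw [hP, Polynomial.eval_map_algebraMap]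
  have hP0 : P ≠ 0 := by
    intro h
    have := hne 0 (by simpa using hδ.le)
    rw [hev, h] at this
    simp at this
  have hfac : ∀ w : ℂ, ‖P.eval w‖ =
      ‖P.leadingCoeff‖ * (P.roots.map fun r => ‖w - r‖).prod := by
    intro w
    conv_lhs => rw [(IsAlgClosed.splits P).eq_prod_roots]
    rw [Polynomial.eval_mul, Polynomial.eval_C, norm_mul, Polynomial.eval_multiset_prod]
    have := map_multiset_prod (normHom : ℂ →*₀ ℝ)
      ((P.roots.map fun r => Polynomial.X - Polynomial.C r).map (Polynomial.eval w))
    simp only [Multiset.map_map, Function.comp_def, Polynomial.eval_sub,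
      Polynomial.eval_X, Polynomial.eval_C] at this ⊢
    exact congrArg (‖P.leadingCoeff‖ * ·) this
  have hroots : ∀ r ∈ P.roots, r ≠ 0 ∧ r.im = 0 ∧ |δ| ≤ |r.re| := by
    intro r hr
    have hr0 : Polynomial.aeval r p = 0 := by
      rw [hev]; exact (Polynomial.mem_roots hP0).1 hr
    have him := hp r hr0
    have hrr : r = (r.re : ℂ) := Complex.ext (by simp) (by simp [him])
    have hlt : δ < |r.re| := by
      by_contra! h
      exact hne r.re h (hrr ▸ hr0)
    refine ⟨?_, him, ?_⟩
    · rintro rfl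
      simp at hlt
      linarith
    · rw [abs_of_pos hδ]; exact hlt.le
  have hprod : ∀ w : ℂ, ‖P.eval w‖ * ‖P.eval (-w)‖ =
      ‖P.leadingCoeff‖ ^ 2 * (P.roots.map fun r => ‖w - r‖ * ‖-w - r‖).prod := by
    intro w
    rw [hfac, hfac, Multiset.prod_map_mul]
    ring
  have hzero : ‖P.eval 0‖ ^ 2 =
      ‖P.leadingCoeff‖ ^ 2 * (P.roots.map fun r => ‖r‖ ^ 2).prod := by
    rw [hfac, Multiset.prod_map_pow]
    simp [mul_pow]
  simp only [hev] at hL ⊢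
  set S := (P.roots.map fun r => (‖r‖ ^ 2)⁻¹).sum
  have h0 : 0 < ‖P.eval 0‖ ^ 2 := by
    have := hne 0 (by simpa using hδ.le)
    rw [hev] at this
    have := norm_pos_iff.2 this
    simpa using pow_pos this 2
  have hS : S ≤ L / δ ^ 2 := by
    have h1 : Real.exp (-L) * ‖P.eval 0‖ ^ 2 ≤ ‖P.eval 0‖ ^ 2 * Real.exp (-(δ ^ 2 * S)) := by
      refine hL.trans ?_
      rw [hprod, hzero, mul_assoc]
      gcongr
      exact prod_norm_sub_mul_le_of_real _ hroots
    have h2 : Real.exp (-L) ≤ Real.exp (-(δ ^ 2 * S)) := by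
      rw [mul_comm] at h1
      exact le_of_mul_le_mul_left h1 h0
    have h3 := Real.exp_le_exp.1 h2
    rw [le_div_iff₀ (by positivity)]
    linarith
  rw [hprod]
  calc _ ≤ ‖P.leadingCoeff‖ ^ 2 * ((P.roots.map fun r => ‖r‖ ^ 2).prod *
        Real.exp (‖z‖ ^ 2 * S)) := by
        gcongr
        exact prod_norm_sub_mul_le _ (fun r hr => (hroots r hr).1) z
    _ = ‖P.eval 0‖ ^ 2 * Real.exp (S * ‖z‖ ^ 2) := by rw [hzero]; ring_nf
    _ ≤ _ := by gcongr

/-- A growth bound for even Laguerre-Pólya functions in terms of their values on `[-δ, δ]`. -/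
theorem norm_sq_le_of_mem_evenLaguerrePolya {φ : ℂ → ℂ} (hφ : φ ∈ EvenLaguerrePolya) {δ : ℝ} (hδ : 0 < δ)
    (hb : ∀ t : ℝ, |t| ≤ δ → 1 / 2 ≤ ‖φ t‖) (z : ℂ) :
    ‖φ z‖ ^ 2 ≤ 2 * Real.exp (Real.log 32 / δ ^ 2 * ‖z‖ ^ 2) := by
  obtain ⟨⟨hd, p, hp, hlim⟩, heven, hone⟩ := hφ
  have hpt : ∀ w, Tendsto (fun n => Polynomial.aeval w (p n)) atTop (𝓝 (φ w)) :=
    fun w => (tendstoLocallyUniformlyOn_univ.2 hlim).tendsto_at (Set.mem_univ w)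
  have hlow : ∀ᶠ n in atTop, ∀ t : ℝ, |t| ≤ δ → 1 / 4 ≤ ‖Polynomial.aeval (t : ℂ) (p n)‖ := by
    have := (tendstoLocallyUniformly_iff_forall_isCompact.1 hlim) (closedBall 0 δ)
      (isCompact_closedBall _ _)
    filter_upwards [Metric.tendstoUniformlyOn_iff.1 this (1 / 4) (by norm_num)] with n hn t ht
    have h1 := hn t (by simpa using ht)
    have h2 := hb t ht
    rw [dist_eq_norm] at h1
    linarith [norm_sub_norm_le (φ t) (Polynomial.aeval (t : ℂ) (p n))]
  have h0 : ∀ᶠ n in atTop, ‖Polynomial.aeval (0 : ℂ) (p n)‖ ^ 2 ≤ 2 := by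
    have := ((hpt 0).norm.pow 2)
    rw [hone] at this
    refine this.eventually_le_const (by norm_num)
  have hbound : ∀ᶠ n in atTop, ‖Polynomial.aeval z (p n)‖ * ‖Polynomial.aeval (-z) (p n)‖ ≤
      2 * Real.exp (Real.log 32 / δ ^ 2 * ‖z‖ ^ 2) := by
    filter_upwards [hlow, h0] with n hn hn0
    -- The constant satisfies `2 / 32 = (1/4)²`: the upper bound `2` for `|p(0)|²` against the lower
    -- bound `1/4` at each of `±δ`.
    refine (norm_aeval_mul_aeval_neg_le (hp n) (L := Real.log 32) hδ (fun t ht h => ?_) ?_ z).trans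
      (by gcongr)
    · have := hn t ht
      rw [h, norm_zero] at this
      norm_num at this
    · have h1 := hn δ (abs_of_pos hδ).le
      have h2 := hn (-δ) (by rw [abs_neg, abs_of_pos hδ])
      push_cast at h2
      rw [Real.exp_neg, Real.exp_log (by norm_num)]
      nlinarith
  have := le_of_tendsto ((hpt z).norm.mul (hpt (-z)).norm) hbound
  rwa [heven, ← sq] at this

/-- Locally uniform limits of Laguerre-Pólya functions are Laguerre-Pólya functions. -/
theorem LaguerrePolya_of_tendstoLocallyUniformly {ι : Type*} {l : Filter ι} [l.NeBot]
    {φ : ι → ℂ → ℂ} {ψ : ℂ → ℂ} (hφ : ∀ᶠ i in l, φ i ∈ LaguerrePolya)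
    (hlim : TendstoLocallyUniformly φ ψ l) : ψ ∈ LaguerrePolya := by
  have hd : Differentiable ℂ ψ := by
    rw [← differentiableOn_univ]
    exact (tendstoLocallyUniformlyOn_univ.2 hlim).differentiableOn
      (hφ.mono fun i hi => hi.1.differentiableOn) isOpen_univ
  -- Diagonal choice: half of the error is spent on approximating `ψ` by some `φ i`, half on
  -- approximating `φ i` by a polynomial.
  have hex : ∀ n : ℕ, ∃ q : Polynomial ℝ, (∀ z : ℂ, Polynomial.aeval z q = 0 → z.im = 0) ∧
      ∀ z ∈ closedBall (0 : ℂ) n, dist (ψ z) (Polynomial.aeval z q) < 1 / ((n : ℝ) + 1) := by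
    intro n
    have hε : (0 : ℝ) < 1 / ((n : ℝ) + 1) / 2 := by positivity
    have h1 := Metric.tendstoUniformlyOn_iff.1 ((tendstoLocallyUniformly_iff_forall_isCompact.1
      hlim) (closedBall 0 n) (isCompact_closedBall _ _)) _ hε
    obtain ⟨i, ⟨-, p, hp, hpl⟩, hi⟩ := (hφ.and h1).exists
    have h2 := Metric.tendstoUniformlyOn_iff.1 ((tendstoLocallyUniformly_iff_forall_isCompact.1
      hpl) (closedBall 0 n) (isCompact_closedBall _ _)) _ hε
    obtain ⟨m, hm⟩ := h2.exists
    refine ⟨p m, hp m, fun z hz => ?_⟩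
    have := dist_triangle (ψ z) (φ i z) (Polynomial.aeval z (p m))
    linarith [hi z hz, hm z hz]
  choose q hq hqd using hex
  refine ⟨hd, q, hq, ?_⟩
  rw [Metric.tendstoLocallyUniformly_iff]
  intro ε hε z
  refine ⟨ball z 1, ball_mem_nhds z one_pos, ?_⟩
  obtain ⟨N, hN⟩ := exists_nat_gt (‖z‖ + 1)
  filter_upwards [eventually_ge_atTop N,
    (tendsto_one_div_add_atTop_nhds_zero_nat (𝕜 := ℝ)).eventually_lt_const hε] with n hn hnε w hw
  refine (hqd n w ?_).trans hnε
  rw [mem_closedBall_zero_iff]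
  have h1 : ‖w‖ ≤ ‖z‖ + ‖w - z‖ := by
    conv_lhs => rw [← add_sub_cancel z w]
    exact norm_add_le _ _
  have h2 := mem_ball_iff_norm.1 hw
  have h3 : (N : ℝ) ≤ n := by exact_mod_cast hn
  linarith

theorem classDL_closed : ClosedUnderLocallyUniformConvergence classDL := by
  intro F G hF hlim
  have hG : G ∈ PPlus := PPlus_of_tendstoLocallyUniformly (fun n => (hF n).1) hlim
  refine ⟨hG, ?_⟩
  choose hFP φ hφ hFφ using hF
  obtain ⟨δ, hδ, hhalf⟩ := exists_eventually_half_le_norm (l := atTop) hG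
    fun ε hε => Metric.tendstoLocallyUniformly_iff.1 hlim ε hε 0
  let U : Ultrafilter ℕ := Ultrafilter.of atTop
  have hU : (U : Filter ℕ) ≤ atTop := Ultrafilter.of_le _
  obtain ⟨ψ, -, hψ⟩ := exists_tendstoLocallyUniformlyOn_ultrafilter U isOpen_univ (f := φ)
    (Eventually.of_forall fun n => (hφ n).1.1.differentiableOn) fun z _ => by
      refine ⟨ball z 1, ball_mem_nhds z one_pos,
        2 * Real.exp (Real.log 32 / δ ^ 2 * (‖z‖ + 1) ^ 2) + 1, ?_⟩
      filter_upwards [hU hhalf] with n hn w hw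
      have h1 := norm_sq_le_of_mem_evenLaguerrePolya (hφ n) hδ (fun t ht => hFφ n t ▸ hn t ht) w
      have h2 : ‖w‖ ≤ ‖z‖ + 1 := by
        have h1 : ‖w‖ ≤ ‖z‖ + ‖w - z‖ := by
          conv_lhs => rw [← add_sub_cancel z w]
          exact norm_add_le _ _
        linarith [mem_ball_iff_norm.1 hw]
      have h3 : ‖φ n w‖ ^ 2 ≤ 2 * Real.exp (Real.log 32 / δ ^ 2 * (‖z‖ + 1) ^ 2) :=
        h1.trans (by gcongr)
      nlinarith [sq_nonneg (‖φ n w‖ - 1), norm_nonneg (φ n w)]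
  have hpt : ∀ z, Tendsto (fun n => φ n z) U (𝓝 (ψ z)) := fun z => hψ.tendsto_at (Set.mem_univ z)
  refine ⟨ψ, ⟨LaguerrePolya_of_tendstoLocallyUniformly (Eventually.of_forall fun n => (hφ n).1)
    (tendstoLocallyUniformlyOn_univ.1 hψ), fun z => ?_, ?_⟩, fun t => ?_⟩
  · refine tendsto_nhds_unique (hpt (-z)) ((hpt z).congr fun n => ?_)
    exact ((hφ n).2.1 z).symm
  · refine tendsto_nhds_unique (hpt 0) (tendsto_const_nhds.congr fun n => ?_)
    exact (hφ n).2.2.symm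
  · refine tendsto_nhds_unique (((tendstoLocallyUniformlyOn_univ.2 hlim).tendsto_at
      (Set.mem_univ t)).mono_left hU) ((hpt t).congr fun n => ?_)
    exact (hFφ n t).symm

end VanDantzig

/-! ### Bochner's theorem -/

/-- The existence part of Lévy's continuity theorem on `ℝ`. -/
theorem exists_charFun_eq_of_tendsto {μ : ℕ → ProbabilityMeasure ℝ} {F : ℝ → ℂ}
    (hF : ContinuousAt F 0)
    (h : ∀ t, Tendsto (fun n => charFun (μ n : Measure ℝ) t) atTop (𝓝 (F t))) :
    ∃ ν : ProbabilityMeasure ℝ, charFun (ν : Measure ℝ) = F := by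
  have h_tight : IsTightMeasureSet {((μ n : ProbabilityMeasure ℝ) : Measure ℝ) | n} :=
    isTightMeasureSet_of_tendsto_charFun hF h
  have h_compact : IsCompact (closure (Set.range μ)) :=
    isCompact_closure_of_isTightMeasureSet (by simpa using h_tight)
  obtain ⟨ν, -, hν : Tendsto μ (Ultrafilter.of atTop : Ultrafilter ℕ) (𝓝 ν)⟩ :=
    h_compact.ultrafilter_le_nhds ((Ultrafilter.of atTop).map μ)
      (.trans (by simp) (monotone_principal subset_closure))
  refine ⟨ν, funext fun t => tendsto_nhds_unique (l := (Ultrafilter.of atTop : Ultrafilter ℕ))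
    (f := fun n => charFun (μ n : Measure ℝ) t) ?_ ((h t).mono_left (Ultrafilter.of_le _))⟩
  rw [ProbabilityMeasure.tendsto_iff_forall_integral_rclike_tendsto ℂ] at hν
  have := hν (BoundedContinuousFunction.innerProbChar t)
  simpa [charFun_eq_integral_innerProbChar] using this

/-- The expectation of a positive-definite function of the difference of two independent
identically distributed variables is nonnegative. -/
theorem integral_sub_prod_nonneg {H : ℝ → ℂ} (hc : Continuous H) {C : ℝ} (hb : ∀ t, ‖H t‖ ≤ C)
    (hpos : ∀ (n : ℕ) (t : Fin n → ℝ), 0 ≤ ∑ j, ∑ k, H (t j - t k))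
    (ν : Measure ℝ) [IsProbabilityMeasure ν] :
    0 ≤ ∫ z, H (z.1 - z.2) ∂(ν.prod ν) := by
  set J := ∫ z, H (z.1 - z.2) ∂(ν.prod ν) with hJ
  have hint : ∀ (n : ℕ) (j k : Fin n),
      Integrable (fun t : Fin n → ℝ => H (t j - t k)) (Measure.pi fun _ => ν) := fun n j k =>
    Integrable.of_bound (by fun_prop) C (Eventually.of_forall fun t => hb _)
  have hterm : ∀ (n : ℕ) (j k : Fin n),
      ∫ t : Fin n → ℝ, H (t j - t k) ∂(Measure.pi fun _ => ν) = if j = k then H 0 else J := by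
    intro n j k
    split_ifs with hjk
    · subst hjk
      simp
    · have hind : IndepFun (fun t : Fin n → ℝ => t j) (fun t : Fin n → ℝ => t k)
          (Measure.pi fun _ => ν) :=
        (iIndepFun_pi (μ := fun _ : Fin n => ν) (X := fun _ => id)
          (fun _ => aemeasurable_id)).indepFun hjk
      have hmap := (indepFun_iff_map_prod_eq_prod_map_map (measurable_pi_apply j).aemeasurable
        (measurable_pi_apply k).aemeasurable).1 hind
      have he : ∀ i : Fin n, (Measure.pi fun _ : Fin n => ν).map (fun t => t i) = ν := fun i =>
        (measurePreserving_eval (fun _ : Fin n => ν) i).map_eq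
      rw [he, he] at hmap
      rw [hJ, ← hmap, integral_map (by fun_prop) (by fun_prop)]
  -- Averaging over `n` independent samples, the diagonal contributes `n H(0)` and each off-diagonal
  -- pair contributes `J`. Division by `n (n - 1)` makes the diagonal negligible.
  have hsum : ∀ n : ℕ, 0 ≤ (n : ℂ) * H 0 + (n * n - n : ℂ) * J := by
    intro n
    have h0 : 0 ≤ ∫ t : Fin n → ℝ, ∑ j, ∑ k, H (t j - t k) ∂(Measure.pi fun _ => ν) :=
      integral_nonneg fun t => hpos n t
    rw [integral_finsetSum _ fun j _ => integrable_finsetSum _ fun k _ => hint n j k] at h0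
    simp_rw [integral_finsetSum _ fun k _ => hint n _ k, hterm] at h0
    convert h0 using 1
    have : ∀ j k : Fin n, (if j = k then H 0 else J) = (if j = k then H 0 - J else 0) + J := by
      intro j k
      split_ifs <;> simp
    simp_rw [this, Finset.sum_add_distrib]
    simp
    ring
  have hlim : Tendsto (fun n : ℕ => ((1 / ((n : ℝ) + 1) : ℝ) : ℂ) * H 0 + J) atTop (𝓝 J) := by
    have := (Complex.continuous_ofReal.tendsto 0).comp
      (tendsto_one_div_add_atTop_nhds_zero_nat (𝕜 := ℝ))
    simpa using (this.mul_const (H 0)).add_const J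
  refine ge_of_tendsto' hlim fun n => ?_
  have h1 := hsum (n + 2)
  have h2 : (0 : ℂ) ≤ ((1 / (((n : ℝ) + 2) * ((n : ℝ) + 1)) : ℝ) : ℂ) := by
    rw [Complex.zero_le_real]; positivity
  convert mul_nonneg h2 h1 using 1
  have h3 : (n : ℂ) + 1 ≠ 0 := by exact_mod_cast Nat.succ_ne_zero n
  have h4 : (n : ℂ) + 2 ≠ 0 := by exact_mod_cast Nat.succ_ne_zero (n + 1)
  push_cast
  field_simp
  ring

/-- Since `q 0` is the total mass of `p dγ`, the required measure has density `p / q 0` with respect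
to `γ`. -/
theorem exists_probabilityMeasure_charFun_eq_div {p : ℝ → ℂ} (hp : Continuous p) {C : ℝ}
    (hb : ∀ t, ‖p t‖ ≤ C) (hpos : ∀ t, 0 ≤ p t) (γ : Measure ℝ) [IsProbabilityMeasure γ]
    {q : ℝ → ℂ} (hq : ∀ t : ℝ, q t = ∫ x, Complex.exp (t * x * Complex.I) * p x ∂γ)
    (hq0 : q 0 ≠ 0) :
    ∃ μ : ProbabilityMeasure ℝ, ∀ t, charFun (μ : Measure ℝ) t = q t / q 0 := by
  have hre : ∀ x, p x = ((p x).re : ℂ) := fun x =>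
    Complex.ext (by simp) (by simpa using ((Complex.nonneg_iff.1 (hpos x)).2).symm)
  have hint : Integrable (fun x => (p x).re) γ :=
    Integrable.of_bound (by fun_prop) C
      (Eventually.of_forall fun t => (Complex.abs_re_le_norm _).trans (hb t))
  set m : ℝ := ∫ x, (p x).re ∂γ with hm
  have hqm : q 0 = m := by
    rw [hq, hm, ← integral_complex_ofReal]
    refine integral_congr_ae (Eventually.of_forall fun x => ?_)
    simp [← hre x]
  have hm0 : 0 < m := by
    refine lt_of_le_of_ne (integral_nonneg fun x => (Complex.nonneg_iff.1 (hpos x)).1) fun h => ?_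
    rw [hqm, ← h] at hq0
    simp at hq0
  have hdpos : ∀ x, 0 ≤ (p x).re / m := fun x =>
    div_nonneg (Complex.nonneg_iff.1 (hpos x)).1 hm0.le
  have hprob : IsProbabilityMeasure (γ.withDensity fun x => ENNReal.ofReal ((p x).re / m)) := by
    constructor
    rw [withDensity_apply _ MeasurableSet.univ, Measure.restrict_univ,
      ← ofReal_integral_eq_lintegral_ofReal (hint.div_const m) (Eventually.of_forall hdpos),
      integral_div, ← hm, div_self hm0.ne', ENNReal.ofReal_one]
  refine ⟨⟨_, hprob⟩, fun t => ?_⟩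
  rw [ProbabilityMeasure.coe_mk, charFun_apply_real,
    integral_withDensity_eq_integral_toReal_smul (by fun_prop)
    (Eventually.of_forall fun _ => ENNReal.ofReal_lt_top), hqm, hq t, ← integral_div]
  refine integral_congr_ae (Eventually.of_forall fun x => ?_)
  simp only [ENNReal.toReal_ofReal (hdpos x), Complex.real_smul]
  conv_rhs => rw [hre x]
  push_cast
  ring

namespace VanDantzig

theorem PPlus_sum_nonneg {F : ℝ → ℂ} (hF : F ∈ PPlus) (x : ℝ) (n : ℕ) (t : Fin n → ℝ) :
    0 ≤ ∑ j, ∑ k, F (t j - t k) * Complex.exp (-((t j - t k : ℝ) * x * Complex.I)) := by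
  have h := (hF.2.2.1 n t).dotProduct_mulVec_nonneg
    (fun k => Complex.exp (t k * x * Complex.I))
  convert h using 1
  simp only [dotProduct, Matrix.mulVec, Matrix.of_apply, Pi.star_apply, Finset.mul_sum]
  refine Finset.sum_congr rfl fun j _ => Finset.sum_congr rfl fun k _ => ?_
  rw [Complex.star_def, ← Complex.exp_conj, mul_left_comm, ← Complex.exp_add]
  congr 2
  simp
  ring

theorem integral_gaussianReal_prod_sub {E : Type*} [NormedAddCommGroup E] [NormedSpace ℝ E]
    {H : ℝ → E} (hc : Continuous H) (v : NNReal) :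
    ∫ z, H (z.1 - z.2) ∂((gaussianReal 0 v).prod (gaussianReal 0 v)) =
      ∫ u, H u ∂(gaussianReal 0 (v + v)) := by
  have h1 : gaussianReal 0 (v + v) = (((gaussianReal 0 v).prod (gaussianReal 0 v)).map
      (fun z : ℝ × ℝ => z.1 - z.2)) := by
    have h2 := gaussianReal_conv_gaussianReal (m₁ := 0) (m₂ := 0) (v₁ := v) (v₂ := v)
    rw [add_zero] at h2
    rw [← h2, Measure.conv]
    have h3 : gaussianReal 0 v = (gaussianReal 0 v).map (fun x => -x) := by
      rw [gaussianReal_map_neg, neg_zero]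
    conv_lhs => enter [2, 2]; rw [h3]
    have h4 : (gaussianReal 0 v) = (gaussianReal 0 v).map id := Measure.map_id.symm
    conv_lhs => enter [2, 1]; rw [h4]
    rw [Measure.map_prod_map _ _ measurable_id measurable_neg,
      Measure.map_map (by fun_prop) (by fun_prop)]
    rfl
  rw [h1, integral_map (by fun_prop) (by fun_prop)]

/-- The exponential on the left is an unnormalized density of `N(t, 1/m)`, while the density of
`N(0, 2m)` is a multiple of `exp(-u²/(4m))`. The two trade places, and `k` is the ratio of
normalizing constants, independent of `t`. -/
theorem exp_smul_gaussianReal_integral {H : ℝ → ℂ} {m : NNReal} (hm : 0 < m) :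
    ∃ k : ℝ, 0 < k ∧ ∀ t : ℝ, ∫ u, H u * Complex.exp (-(m * (t - u) ^ 2 / 2))
      ∂(gaussianReal 0 (m + m)) =
      k * ∫ u, H u * Complex.exp (-(u ^ 2 / (4 * m))) ∂(gaussianReal t m⁻¹) := by
  have hm' : (0 : ℝ) < m := hm
  refine ⟨√(2 * Real.pi * m⁻¹) / √(2 * Real.pi * (m + m)), by positivity, fun t => ?_⟩
  rw [integral_gaussianReal_eq_integral_smul (by positivity),
    integral_gaussianReal_eq_integral_smul (by positivity), ← integral_const_mul]
  refine integral_congr_ae (Eventually.of_forall fun u => ?_)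
  simp only [gaussianPDFReal_def, Complex.real_smul]
  push_cast
  have e1 : (-((u : ℂ) - 0) ^ 2 / (2 * (m + m))) = -(u ^ 2 / (4 * m)) := by ring
  have e2 : (-((u : ℂ) - t) ^ 2 / (2 * (m : ℂ)⁻¹)) = -(m * (t - u) ^ 2 / 2) := by
    field_simp
    ring
  have h1 : ((√(2 * Real.pi * (m : ℝ)⁻¹) : ℝ) : ℂ) ≠ 0 := by
    have : (0 : ℝ) < √(2 * Real.pi * (m : ℝ)⁻¹) := by positivity
    exact_mod_cast this.ne'
  rw [e1, e2]
  field_simp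

/-- Under the substitution `u = t + v / √(n+1)` with `v` standard Gaussian, the argument of `H`
tends to `t` and the exponential factor to `1`; dominated convergence applies. -/
theorem tendsto_integral_gaussianReal_inv {H : ℝ → ℂ} (hc : Continuous H) {C : ℝ}
    (hb : ∀ t, ‖H t‖ ≤ C) (t : ℝ) :
    Tendsto (fun n : ℕ => ∫ u, H u * Complex.exp (-(u ^ 2 / (4 * ((n : NNReal) + 1 : NNReal))))
      ∂(gaussianReal t ((n : NNReal) + 1)⁻¹)) atTop (𝓝 (H t)) := by
  have hmap : ∀ n : ℕ, gaussianReal t ((n : NNReal) + 1)⁻¹ =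
      (gaussianReal 0 1).map fun v => t + (√((n : ℝ) + 1))⁻¹ * v := by
    intro n
    have h1 : (fun v : ℝ => t + (√((n : ℝ) + 1))⁻¹ * v) =
      (fun v => t + v) ∘ (fun v => (√((n : ℝ) + 1))⁻¹ * v) := rfl
    rw [h1, ← Measure.map_map (by fun_prop) (by fun_prop), gaussianReal_map_const_mul,
      gaussianReal_map_const_add]
    congr 1
    · simp
    · ext
      simp only [NNReal.coe_inv, NNReal.coe_add, NNReal.coe_natCast, NNReal.coe_one, mul_one,
        NNReal.coe_mk, inv_pow]
      rw [Real.sq_sqrt (by positivity)]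
  simp_rw [hmap]
  have heq : ∀ n : ℕ, ∫ u, H u * Complex.exp (-(u ^ 2 / (4 * ((n : NNReal) + 1 : NNReal))))
      ∂((gaussianReal 0 1).map fun v => t + (√((n : ℝ) + 1))⁻¹ * v) =
      ∫ v, H (t + (√((n : ℝ) + 1))⁻¹ * v) * Complex.exp
        (-(((t + (√((n : ℝ) + 1))⁻¹ * v : ℝ) : ℂ) ^ 2 * (((1 / ((n : ℝ) + 1) : ℝ) : ℂ) / 4)))
        ∂(gaussianReal 0 1) := by
    intro n
    rw [integral_map (by fun_prop) (by fun_prop)]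
    refine integral_congr_ae (Eventually.of_forall fun v => ?_)
    simp only
    congr 3
    push_cast
    field_simp
  simp_rw [heq]
  have hlim0 : Tendsto (fun n : ℕ => (√((n : ℝ) + 1))⁻¹) atTop (𝓝 0) :=
    tendsto_inv_atTop_zero.comp (Real.tendsto_sqrt_atTop.comp
      (tendsto_atTop_add_const_right _ _ tendsto_natCast_atTop_atTop))
  have hlim1 := (tendsto_one_div_add_atTop_nhds_zero_nat (𝕜 := ℝ))
  have hconst : H t = ∫ _v : ℝ, H t ∂(gaussianReal 0 1) := by simp
  rw [hconst]
  refine tendsto_integral_of_dominated_convergence (fun _ => C)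
    (fun n => by fun_prop) (integrable_const C) (fun n => Eventually.of_forall fun v => ?_)
    (Eventually.of_forall fun v => ?_)
  · rw [norm_mul]
    have : ‖Complex.exp (-(((t + (√((n : ℝ) + 1))⁻¹ * v : ℝ) : ℂ) ^ 2 *
        (((1 / ((n : ℝ) + 1) : ℝ) : ℂ) / 4)))‖ ≤ 1 := by
      rw [Complex.norm_exp]
      norm_cast
      rw [Real.exp_le_one_iff, neg_nonpos]
      positivity
    calc _ ≤ C * 1 := mul_le_mul (hb _) this (norm_nonneg _) ((norm_nonneg _).trans (hb 0))
      _ = C := mul_one C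
  · have h1 : Tendsto (fun n : ℕ => t + (√((n : ℝ) + 1))⁻¹ * v) atTop (𝓝 t) := by
      simpa using (hlim0.mul_const v).const_add t
    have h2 : Tendsto (fun n : ℕ => Complex.exp (-(((t + (√((n : ℝ) + 1))⁻¹ * v : ℝ) : ℂ) ^ 2 *
        (((1 / ((n : ℝ) + 1) : ℝ) : ℂ) / 4)))) atTop (𝓝 1) := by
      have h3 := ((Complex.continuous_ofReal.tendsto _).comp h1).pow 2
      have h4 := ((Complex.continuous_ofReal.tendsto _).comp hlim1).div_const 4
      have h5 := (Complex.continuous_exp.tendsto _).comp (h3.mul h4).neg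
      simpa [Function.comp_def] using h5
    simpa using ((hc.tendsto t).comp h1).mul h2

/-- Bochner's theorem on `ℝ`. -/
theorem exists_charFun_eq_of_mem_PPlus {F : ℝ → ℂ} (hF : F ∈ PPlus) :
    ∃ μ : ProbabilityMeasure ℝ, charFun (μ : Measure ℝ) = F := by
  have hFc : Continuous F := hF.1
  set A : ℕ → ℝ → ℂ := fun n t => ∫ u, F u *
    Complex.exp (-(u ^ 2 / (4 * ((n : NNReal) + 1 : NNReal)))) ∂(gaussianReal t ((n : NNReal) + 1)⁻¹)
    with hA
  have hAlim : ∀ t, Tendsto (fun n => A n t) atTop (𝓝 (F t)) := fun t =>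
    tendsto_integral_gaussianReal_inv hFc (PPlus_norm_le_one hF) t
  have hex : ∀ n, ∃ μ : ProbabilityMeasure ℝ, A n 0 ≠ 0 →
      ∀ t, charFun (μ : Measure ℝ) t = A n t / A n 0 := by
    intro n
    by_cases hn : A n 0 = 0
    -- An arbitrary measure: since `A n 0 → 1`, this case occurs for finitely many `n` only.
    · exact ⟨⟨gaussianReal 0 1, inferInstance⟩, fun h => absurd hn h⟩
    set m : NNReal := (n : NNReal) + 1 with hm
    have hmpos : 0 < m := by positivity
    obtain ⟨k, hk, hkA⟩ := exp_smul_gaussianReal_integral (H := F) hmpos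
    set ν := gaussianReal 0 m with hν
    -- A regularized inverse Fourier transform of `F`: averaging over the difference of two
    -- independent Gaussians makes it nonnegative by positive-definiteness.
    let p : ℝ → ℂ := fun x => ∫ z : ℝ × ℝ, F (z.1 - z.2) *
      Complex.exp (-((z.1 - z.2 : ℝ) * x * Complex.I)) ∂(ν.prod ν)
    have hnorm : ∀ s x : ℝ, ‖F s * Complex.exp (-((s : ℂ) * x * Complex.I))‖ ≤ 1 := by
      intro s x
      rw [norm_mul, ← neg_mul]
      have : ‖Complex.exp (-((s : ℂ) * x) * Complex.I)‖ = 1 := by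
        have := Complex.norm_exp_ofReal_mul_I (-(s * x))
        push_cast at this
        exact this
      rw [this, mul_one]
      exact PPlus_norm_le_one hF s
    have hp : Continuous p := by
      refine continuous_of_dominated (bound := fun _ => 1) (fun x => by fun_prop)
        (fun x => Eventually.of_forall fun z => hnorm _ _) (integrable_const _)
        (Eventually.of_forall fun z => by fun_prop)
    have hpb : ∀ x, ‖p x‖ ≤ 1 := fun x => by
      refine (norm_integral_le_of_norm_le_const (Eventually.of_forall fun z => hnorm _ _)).trans ?_
      simp
    have hppos : ∀ x, 0 ≤ p x := fun x =>
      integral_sub_prod_nonneg (H := fun s => F s * Complex.exp (-((s : ℂ) * x * Complex.I)))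
        (by fun_prop) (fun t => hnorm t x) (fun n t => PPlus_sum_nonneg hF x n t) ν
    have hq : ∀ t : ℝ, (k : ℂ) * A n t = ∫ x, Complex.exp (t * x * Complex.I) * p x ∂ν := by
      intro t
      have h1 : ∀ x : ℝ, Complex.exp (t * x * Complex.I) * p x = ∫ z : ℝ × ℝ,
          F (z.1 - z.2) * Complex.exp ((t - (z.1 - z.2) : ℝ) * x * Complex.I) ∂(ν.prod ν) := by
        intro x
        rw [← integral_const_mul]
        refine integral_congr_ae (Eventually.of_forall fun z => ?_)
        simp only
        rw [mul_left_comm, ← Complex.exp_add]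
        congr 2
        push_cast
        ring
      simp_rw [h1]
      -- After Fubini, the inner integral over `x` is the Gaussian characteristic function at `t -
      -- (z.1 - z.2)`, and the difference `z.1 - z.2` has law `N(0, 2m)`.
      rw [integral_integral_swap]
      · have h2 : ∀ z : ℝ × ℝ, ∫ x, F (z.1 - z.2) *
            Complex.exp ((t - (z.1 - z.2) : ℝ) * x * Complex.I) ∂ν =
            F (z.1 - z.2) * Complex.exp (-(m * (t - (z.1 - z.2 : ℝ)) ^ 2 / 2)) := by
          intro z
          rw [integral_const_mul, ← charFun_apply_real, hν, charFun_gaussianReal]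
          congr 2
          push_cast
          ring
        simp_rw [h2]
        rw [hν, integral_gaussianReal_prod_sub
          (H := fun u : ℝ => F u * Complex.exp (-(m * (t - (u : ℂ)) ^ 2 / 2))) (by fun_prop), hkA]
      · refine Integrable.of_bound (by fun_prop) 1 (Eventually.of_forall fun z => ?_)
        simp only [Function.uncurry]
        rw [norm_mul, ← Complex.ofReal_mul, Complex.norm_exp_ofReal_mul_I, mul_one]
        exact PPlus_norm_le_one hF _
    have hk0 : (k : ℂ) ≠ 0 := by exact_mod_cast hk.ne'
    obtain ⟨μ, hμ⟩ := exists_probabilityMeasure_charFun_eq_div hp hpb hppos ν hq (by simp [hk0, hn])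
    refine ⟨μ, fun _ t => ?_⟩
    rw [hμ, mul_div_mul_left _ _ hk0]
  choose μ hμ using hex
  refine exists_charFun_eq_of_tendsto (μ := μ) hFc.continuousAt fun t => ?_
  have h0 := hAlim 0
  rw [hF.2.2.2] at h0
  have hdiv := (hAlim t).div h0 one_ne_zero
  rw [div_one] at hdiv
  refine hdiv.congr' ?_
  filter_upwards [h0.eventually_ne one_ne_zero] with n hn
  exact (hμ n hn t).symm

end VanDantzig

/-! ### Analytic characteristic functions and exponential moments -/

theorem iteratedDeriv_comp_const_mul_left (n : ℕ) (f : ℂ → ℂ) (c : ℂ) :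
    iteratedDeriv n (fun w => f (c * w)) = fun w => c ^ n * iteratedDeriv n f (c * w) := by
  induction n with
  | zero => simp
  | succ n ih =>
    rw [iteratedDeriv_succ, ih]
    ext w
    rw [deriv_const_mul_field, deriv_comp_mul_left, iteratedDeriv_succ, smul_eq_mul, pow_succ]
    ring

theorem AnalyticAt.analyticAt_iteratedDeriv {f : ℂ → ℂ} {z : ℂ} (hf : AnalyticAt ℂ f z) (n : ℕ) :
    AnalyticAt ℂ (iteratedDeriv n f) z := by
  rw [iteratedDeriv_eq_iterate]
  exact hf.iterated_deriv n

/-- An analytic function on a neighbourhood of `[0, b]` all of whose derivatives at `0` are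
nonnegative is nonnegative on `[0, b]`. -/
theorem nonneg_of_iteratedDeriv_nonneg_zero {D : ℂ → ℂ} {b : ℝ} (hb : 0 ≤ b)
    (hD : ∀ y ∈ Set.Icc 0 b, AnalyticAt ℂ D ((y : ℝ) : ℂ))
    (h0 : ∀ n, 0 ≤ iteratedDeriv n D 0) : 0 ≤ D b := by
  -- Continuous induction: the Taylor disc at `0` need not reach `b`, but nonnegativity of all
  -- derivatives propagates to the right within each Taylor disc and passes to limits.
  set s : Set ℝ := {y | ∀ n, 0 ≤ iteratedDeriv n D y} with hs
  have hclosed : IsClosed (s ∩ Set.Icc 0 b) := by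
    have : s ∩ Set.Icc 0 b = ⋂ n, (Set.Icc 0 b ∩ (fun y : ℝ => iteratedDeriv n D y) ⁻¹' Set.Ici 0) := by
      ext y
      simp only [hs, Set.mem_inter_iff, Set.mem_ofPred_eq, Set.mem_iInter, Set.mem_preimage,
        Set.mem_Ici]
      exact ⟨fun h n => ⟨h.2, h.1 n⟩, fun h => ⟨fun n => (h n).2, (h 0).1⟩⟩
    rw [this]
    refine isClosed_iInter fun n => ContinuousOn.preimage_isClosed_of_isClosed (fun y hy => ?_)
      isClosed_Icc isClosed_Ici
    exact (((hD y hy).analyticAt_iteratedDeriv n).continuousAt.comp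
      Complex.continuous_ofReal.continuousAt).continuousWithinAt
  have hsub : Set.Icc 0 b ⊆ s := by
    refine hclosed.Icc_subset_of_forall_exists_gt (by simpa [hs] using h0) ?_
    rintro x ⟨hxs, hx⟩ y hy
    obtain ⟨r, hr, hball⟩ := (hD x ⟨hx.1, hx.2.le⟩).exists_ball_analyticOnNhd
    refine ⟨min y (x + r / 2), fun n => ?_, lt_min hy (by linarith), min_le_left _ _⟩
    refine DifferentiableOn.nonneg_of_iteratedDeriv_nonneg (c := (x : ℂ)) (r := r)
      (fun z hz => ((hball z hz).analyticAt_iteratedDeriv n).differentiableAt.differentiableWithinAt)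
      (fun m => ?_) ?_ ?_
    · have := hxs (m + n)
      rw [iteratedDeriv_eq_iterate] at this ⊢
      rw [iteratedDeriv_eq_iterate, ← Function.iterate_add_apply]
      exact this
    · rw [Complex.real_le_real]
      exact le_min hy.le (by linarith)
    · rw [mem_ball, dist_eq_norm, ← Complex.ofReal_sub, Complex.norm_real, Real.norm_eq_abs,
        abs_of_nonneg (sub_nonneg.2 (le_min hy.le (by linarith)))]
      linarith [min_le_right y (x + r / 2)]
  simpa using hsub (Set.right_mem_Icc.2 hb) 0

/-- Subtracting the Taylor polynomial kills the derivatives at `0` of order below `N` and keeps the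
others, so the remainder satisfies the hypotheses of `nonneg_of_iteratedDeriv_nonneg_zero`. -/
theorem sum_taylor_le_of_iteratedDeriv_nonneg {D : ℂ → ℂ} {b : ℝ} (hb : 0 ≤ b)
    (hD : ∀ y ∈ Set.Icc 0 b, AnalyticAt ℂ D ((y : ℝ) : ℂ))
    (h0 : ∀ n, 0 ≤ iteratedDeriv n D 0) (N : ℕ) :
    ∑ k ∈ Finset.range N, iteratedDeriv k D 0 / k.factorial * (b : ℂ) ^ k ≤ D b := by
  rw [← sub_nonneg]
  refine nonneg_of_iteratedDeriv_nonneg_zero (D := fun w => D w - ∑ k ∈ Finset.range N,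
    iteratedDeriv k D 0 / k.factorial * w ^ k) hb (fun y hy => ?_) fun n => ?_
  · exact (hD y hy).fun_sub (by fun_prop)
  · have hD0 : AnalyticAt ℂ D 0 := by simpa using hD 0 (Set.left_mem_Icc.2 hb)
    rw [iteratedDeriv_fun_sub hD0.contDiffAt (by fun_prop), iteratedDeriv_fun_sum (by fun_prop)]
    have : ∀ k, iteratedDeriv n (fun w : ℂ => iteratedDeriv k D 0 / k.factorial * w ^ k) 0 =
        if n = k then iteratedDeriv n D 0 else 0 := by
      intro k
      rw [iteratedDeriv_const_mul_field, iteratedDeriv_fun_pow_zero]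
      split_ifs with h
      · subst h
        rw [div_mul_cancel₀]
        exact_mod_cast Nat.factorial_ne_zero n
      · simp
    simp_rw [this]
    rw [Finset.sum_ite_eq]
    split_ifs
    · simp
    · simpa using h0 n

/-- The symmetric second difference of the characteristic function at `0` is `-∫ 2 (1 - cos (t x))
dν`, and analyticity makes it `O(t²)`. Dividing by `t²` and applying Fatou's lemma as `t → 0` bounds
the second moment. -/
theorem integrable_sq_of_charFun_analyticAt {ν : Measure ℝ} [IsFiniteMeasure ν] {g : ℂ → ℂ}
    (hg : AnalyticAt ℂ g 0) (h : ∀ᶠ t : ℝ in 𝓝 0, charFun ν t = g t) :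
    Integrable (fun x => x ^ 2) ν := by
  have hO : (fun w : ℂ => g w + g (-w) - 2 * g 0) =O[𝓝 0] fun w => ‖w‖ ^ 2 := by
    obtain ⟨p, hp⟩ := hg
    have h1 := hp.isBigO_sub_partialSum_pow 2
    have hneg : Tendsto (fun w : ℂ => -w) (𝓝 0) (𝓝 0) := by
      simpa using (continuous_neg.tendsto (0 : ℂ))
    have h2 := h1.comp_tendsto hneg
    simp only [Function.comp_def, norm_neg] at h2
    refine (h1.add h2).congr_left fun w => ?_
    have hp0 : p 0 (fun _ => w) = g 0 := hp.coeff_zero _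
    have hp0' : p 0 (fun _ => -w) = g 0 := hp.coeff_zero _
    have hp1 : p 1 (fun _ => -w) = - p 1 (fun _ => w) := by
      simpa only [Finset.prod_const, Finset.card_univ, Fintype.card_fin, pow_one, smul_eq_mul,
        neg_one_mul] using (p 1).map_smul_univ (fun _ => (-1 : ℂ)) (fun _ => w)
    simp only [FormalMultilinearSeries.partialSum, Finset.sum_range_succ, Finset.sum_range_zero,
      hp0, hp0', hp1, zero_add]
    ring
  obtain ⟨K, hK⟩ := hO.bound
  set a : ℕ → ℝ := fun n => 1 / ((n : ℝ) + 1) with ha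
  have hapos : ∀ n, 0 < a n := fun n => by positivity
  have halim : Tendsto a atTop (𝓝 0) := tendsto_one_div_add_atTop_nhds_zero_nat
  have hneg : Tendsto (fun t : ℝ => -t) (𝓝 0) (𝓝 0) := by
    simpa using (continuous_neg.tendsto (0 : ℝ))
  have hcast : Tendsto (fun t : ℝ => (t : ℂ)) (𝓝 0) (𝓝 0) := by
    simpa using (Complex.continuous_ofReal.tendsto 0)
  have hev : ∀ᶠ t : ℝ in 𝓝 0, ∫ x, 2 * (1 - Real.cos (t * x)) ∂ν ≤ K * t ^ 2 := by
    have h0 : charFun ν 0 = g 0 := by simpa using h.self_of_nhds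
    filter_upwards [h, hneg.eventually h, hcast.eventually hK] with t ht1 ht2 ht3
    push_cast at ht2
    rw [← ht1, ← ht2, ← h0] at ht3
    have hint : ∀ s : ℝ, Integrable (fun x : ℝ => Complex.exp (s * x * Complex.I)) ν := fun s => by
      refine Integrable.of_bound (by fun_prop) 1 (Eventually.of_forall fun x => ?_)
      rw [← Complex.ofReal_mul, Complex.norm_exp_ofReal_mul_I]
    have hadd : Integrable (fun x : ℝ => Complex.exp (t * x * Complex.I) +
        Complex.exp ((-t : ℝ) * x * Complex.I)) ν := (hint t).add (hint (-t))
    have hre : ((∫ x, 2 * (1 - Real.cos (t * x)) ∂ν : ℝ) : ℂ) =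
        -(charFun ν t + charFun ν (-t) - 2 * charFun ν 0) := by
      rw [← integral_complex_ofReal, charFun_apply_real, charFun_apply_real, charFun_apply_real,
        ← integral_add (hint t) (hint (-t)), ← integral_const_mul,
        ← integral_sub hadd ((hint 0).const_mul 2), ← integral_neg]
      refine integral_congr_ae (Eventually.of_forall fun x => ?_)
      simp only [Complex.ofReal_zero, zero_mul, Complex.exp_zero, mul_one]
      push_cast
      rw [Complex.cos]
      ring_nf
    rw [← norm_neg, ← hre, Complex.norm_real] at ht3
    refine (le_abs_self _).trans (ht3.trans_eq ?_)
    simp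
  have hfatou : ∫⁻ x, ENNReal.ofReal (x ^ 2) ∂ν ≤ ENNReal.ofReal K := by
    have hlim : ∀ x : ℝ, Tendsto (fun n => ENNReal.ofReal (2 * (1 - Real.cos (a n * x)) / a n ^ 2))
        atTop (𝓝 (ENNReal.ofReal (x ^ 2))) := by
      intro x
      refine (ENNReal.continuous_ofReal.tendsto _).comp ?_
      have h1 : Tendsto (fun n => a n * x / 2) atTop (𝓝 0) := by
        simpa using (halim.mul_const x).div_const 2
      have h2 := (Real.continuous_sinc.tendsto 0).comp h1
      rw [Real.sinc_zero] at h2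
      have h3 := (h2.pow 2).mul_const (x ^ 2)
      rw [one_pow, one_mul] at h3
      refine h3.congr fun n => ?_
      have han := (hapos n).ne'
      have hcos : 1 - Real.cos (a n * x) = 2 * Real.sin (a n * x / 2) ^ 2 := by
        have := Real.cos_sq (a n * x / 2)
        have h5 := Real.sin_sq_add_cos_sq (a n * x / 2)
        rw [show 2 * (a n * x / 2) = a n * x by ring] at this
        linarith
      rw [hcos]
      rcases eq_or_ne x 0 with rfl | hx
      · simp
      · simp only [Function.comp_def]
        rw [Real.sinc_of_ne_zero (by positivity)]
        field_simp
    calc ∫⁻ x, ENNReal.ofReal (x ^ 2) ∂ν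
        = ∫⁻ x, liminf (fun n => ENNReal.ofReal (2 * (1 - Real.cos (a n * x)) / a n ^ 2)) atTop ∂ν :=
          lintegral_congr fun x => (hlim x).liminf_eq.symm
      _ ≤ liminf (fun n => ∫⁻ x, ENNReal.ofReal (2 * (1 - Real.cos (a n * x)) / a n ^ 2) ∂ν) atTop :=
          lintegral_liminf_le fun n => by fun_prop
      _ ≤ ENNReal.ofReal K := by
          refine liminf_le_of_frequently_le' (Eventually.frequently ?_)
          filter_upwards [halim.eventually hev] with n hn
          rw [← ofReal_integral_eq_lintegral_ofReal]
          · refine ENNReal.ofReal_le_ofReal ?_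
            rw [integral_div, div_le_iff₀ (pow_pos (hapos n) 2)]
            exact hn
          · refine Integrable.of_bound (by fun_prop) (4 / a n ^ 2) (Eventually.of_forall fun x => ?_)
            rw [Real.norm_eq_abs, abs_div, abs_of_nonneg (sq_nonneg (a n))]
            gcongr
            rw [abs_le]
            constructor <;> linarith [Real.cos_le_one (a n * x), Real.neg_one_le_cos (a n * x)]
          · refine Eventually.of_forall fun x => div_nonneg ?_ (sq_nonneg _)
            linarith [Real.cos_le_one (a n * x)]
  refine ⟨by fun_prop, ?_⟩
  rw [hasFiniteIntegral_iff_ofReal (Eventually.of_forall fun x => sq_nonneg x)]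
  exact hfatou.trans_lt ENNReal.ofReal_lt_top

theorem iteratedDeriv_comp_ofReal_of_analyticAt (n : ℕ) {g : ℂ → ℂ} {t : ℝ}
    (hg : AnalyticAt ℂ g (t : ℂ)) :
    iteratedDeriv n (fun s : ℝ => g s) t = iteratedDeriv n g t := by
  induction n generalizing t with
  | zero => simp
  | succ n ih =>
    rw [iteratedDeriv_succ, iteratedDeriv_succ]
    have hev : iteratedDeriv n (fun s : ℝ => g s) =ᶠ[𝓝 t] fun s : ℝ => iteratedDeriv n g s := by
      filter_upwards [Complex.continuous_ofReal.continuousAt.eventually hg.eventually_analyticAt]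
        with s hs using ih hs
    rw [hev.deriv_eq]
    exact ((hg.analyticAt_iteratedDeriv n).differentiableAt.hasDerivAt.comp_ofReal).deriv

/-- If the characteristic function of `μ` is analytic at `0`, then all moments of `μ` are finite. -/
theorem integrable_pow_of_charFun_analyticAt {μ : Measure ℝ} [IsFiniteMeasure μ] {f : ℂ → ℂ}
    (hf : AnalyticAt ℂ f 0) (h : ∀ᶠ t : ℝ in 𝓝 0, charFun μ t = f t) (k : ℕ) :
    Integrable (fun x => x ^ (2 * k)) μ ∧ ∀ᶠ t : ℝ in 𝓝 0,
      ∫ x : ℝ, (x : ℂ) ^ (2 * k) * Complex.exp (t * x * Complex.I) ∂μ =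
        (-1) ^ k * iteratedDeriv (2 * k) f t := by
  induction k with
  | zero => simpa [charFun_apply_real] using h
  | succ k ih =>
    obtain ⟨hint, hev⟩ := ih
    have hpos : ∀ x : ℝ, 0 ≤ x ^ (2 * k) := fun x => by rw [pow_mul]; positivity
    -- Near `0` the characteristic function of `x ^ (2k) dμ` is `(-1)^k f^(2k)`, again analytic; its
    -- second moment is the moment of `μ` of order `2k + 2`.
    set ν := μ.withDensity fun x => ENNReal.ofReal (x ^ (2 * k)) with hν
    have : IsFiniteMeasure ν := isFiniteMeasure_withDensity_ofReal hint.2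
    have hcf : ∀ φ : ℝ → ℂ, ∫ x, φ x ∂ν = ∫ x : ℝ, (x : ℂ) ^ (2 * k) * φ x ∂μ := by
      intro φ
      rw [hν, integral_withDensity_eq_integral_toReal_smul (by fun_prop)
        (Eventually.of_forall fun _ => ENNReal.ofReal_lt_top)]
      refine integral_congr_ae (Eventually.of_forall fun x => ?_)
      simp [ENNReal.toReal_ofReal (hpos x)]
    set g : ℂ → ℂ := fun w => (-1) ^ k * iteratedDeriv (2 * k) f w with hg
    have hgan : AnalyticAt ℂ g 0 := analyticAt_const.fun_mul (hf.analyticAt_iteratedDeriv _)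
    have hνg : ∀ᶠ t : ℝ in 𝓝 0, charFun ν t = g t := by
      filter_upwards [hev] with t ht
      rw [charFun_apply_real, hcf, ht]
    have hsq := integrable_sq_of_charFun_analyticAt hgan hνg
    have hmem : MemLp id 2 ν := (memLp_two_iff_integrable_sq (by fun_prop)).2 hsq
    refine ⟨?_, ?_⟩
    · rw [hν, integrable_withDensity_iff_integrable_smul' (by fun_prop)
        (Eventually.of_forall fun _ => ENNReal.ofReal_lt_top)] at hsq
      refine hsq.congr (Eventually.of_forall fun x => ?_)
      simp only [ENNReal.toReal_ofReal (hpos x), smul_eq_mul]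
      ring
    · have hcast : Tendsto (fun t : ℝ => (t : ℂ)) (𝓝 0) (𝓝 0) := by
        simpa using (Complex.continuous_ofReal.tendsto 0)
      filter_upwards [hνg.eventually_nhds, hcast.eventually hgan.eventually_analyticAt] with t ht hgt
      have h1 := iteratedDeriv_charFun (n := 2) (t := t) (μ := ν) hmem
      have h2 : charFun ν =ᶠ[𝓝 t] fun s : ℝ => g s := ht
      rw [h2.iteratedDeriv_eq 2, iteratedDeriv_comp_ofReal_of_analyticAt 2 hgt, hcf, hg,
        iteratedDeriv_const_mul_field, Complex.I_sq] at h1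
      have h3 : iteratedDeriv 2 (iteratedDeriv (2 * k) f) = iteratedDeriv (2 * (k + 1)) f := by
        rw [show 2 * (k + 1) = 2 + 2 * k by ring]
        simp only [iteratedDeriv_eq_iterate, Function.iterate_add_apply]
      rw [h3] at h1
      have h4 : ∀ x : ℝ, (x : ℂ) ^ (2 * (k + 1)) * Complex.exp (t * x * Complex.I) =
          (x : ℂ) ^ (2 * k) * ((x : ℂ) ^ 2 * Complex.exp (t * x * Complex.I)) := fun x => by ring
      simp_rw [h4]
      rw [pow_succ, mul_neg_one, neg_mul, h1]
      ring

/-- If the characteristic function of `μ` extends analytically to a neighbourhood of the segment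
`[-iy, iy]`, then `cosh (y x)` is integrable, with integral bounded by the extension at `± iy`. -/
theorem lintegral_cosh_le_of_charFun_analyticAt {μ : Measure ℝ} [IsFiniteMeasure μ] {f : ℂ → ℂ}
    {y C : ℝ} (hy : 0 ≤ y) (hf : ∀ s : ℝ, |s| ≤ y → AnalyticAt ℂ f (s * Complex.I))
    (h : ∀ᶠ t : ℝ in 𝓝 0, charFun μ t = f t)
    (hC : ‖f (y * Complex.I)‖ ≤ C) (hC' : ‖f ((-y : ℝ) * Complex.I)‖ ≤ C) :
    ∫⁻ x, ENNReal.ofReal (Real.cosh (y * x)) ∂μ ≤ ENNReal.ofReal C := by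
  have hf0 : AnalyticAt ℂ f 0 := by simpa using hf 0 (by simpa using hy)
  have hmom := integrable_pow_of_charFun_analyticAt hf0 h
  -- Formally `D w = 2 ∫ cosh (w x) dμ`. Its derivatives at `0` are twice the even moments, or zero,
  -- so `D y` dominates every Taylor partial sum; the bound on `cosh` follows by summing nonnegative
  -- terms.
  set D : ℂ → ℂ := fun w => f (Complex.I * w) + f (-Complex.I * w) with hD
  have hDan : ∀ s ∈ Set.Icc 0 y, AnalyticAt ℂ D ((s : ℝ) : ℂ) := by
    intro s hs
    have h1 := hf s (by rw [abs_of_nonneg hs.1]; exact hs.2)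
    have h2 := hf (-s) (by rw [abs_neg, abs_of_nonneg hs.1]; exact hs.2)
    refine AnalyticAt.fun_add (AnalyticAt.fun_comp (f := fun w => Complex.I * w) (g := f) ?_
      (by fun_prop)) (AnalyticAt.fun_comp (f := fun w => -Complex.I * w) (g := f) ?_ (by fun_prop))
    · rwa [mul_comm]
    · convert h2 using 1
      push_cast
      ring
  have hder : ∀ n, iteratedDeriv n D 0 =
      (Complex.I ^ n + (-Complex.I) ^ n) * iteratedDeriv n f 0 := by
    intro n
    have hc1 : AnalyticAt ℂ (fun w => f (Complex.I * w)) 0 :=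
      AnalyticAt.fun_comp (f := fun w => Complex.I * w) (g := f) (by simpa using hf0) (by fun_prop)
    have hc2 : AnalyticAt ℂ (fun w => f (-Complex.I * w)) 0 :=
      AnalyticAt.fun_comp (f := fun w => -Complex.I * w) (g := f) (by simpa using hf0) (by fun_prop)
    rw [hD, iteratedDeriv_fun_add hc1.contDiffAt hc2.contDiffAt,
      iteratedDeriv_comp_const_mul_left, iteratedDeriv_comp_const_mul_left]
    simp only [mul_zero]
    ring
  have heven : ∀ k, iteratedDeriv (2 * k) D 0 = ((2 * ∫ x, x ^ (2 * k) ∂μ : ℝ) : ℂ) := by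
    intro k
    have h1 := (hmom k).2.self_of_nhds
    simp only [Complex.ofReal_zero, zero_mul, Complex.exp_zero, mul_one] at h1
    rw [hder, pow_mul, pow_mul, neg_sq, Complex.I_sq, ← two_mul, mul_assoc, ← h1]
    push_cast
    rw [← integral_complex_ofReal]
    push_cast
    rfl
  have hodd : ∀ k, iteratedDeriv (2 * k + 1) D 0 = 0 := by
    intro k
    rw [hder, pow_succ, pow_succ, pow_mul, pow_mul, neg_sq]
    ring
  have hpos : ∀ (k : ℕ) (x : ℝ), 0 ≤ x ^ (2 * k) := fun k x => by rw [pow_mul]; positivity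
  have hnonneg : ∀ n, 0 ≤ iteratedDeriv n D 0 := by
    intro n
    rcases Nat.even_or_odd' n with ⟨k, rfl | rfl⟩
    · rw [heven, Complex.zero_le_real]
      exact mul_nonneg (by norm_num) (integral_nonneg fun x => hpos k x)
    · rw [hodd]
  have hsum : ∀ N : ℕ, ∑ k ∈ Finset.range N, ∫ x, (y * x) ^ (2 * k) / (2 * k).factorial ∂μ ≤ C := by
    intro N
    have h1 := sum_taylor_le_of_iteratedDeriv_nonneg hy hDan hnonneg (2 * N)
    have h2 : ∑ k ∈ Finset.range (2 * N), iteratedDeriv k D 0 / k.factorial * (y : ℂ) ^ k =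
        ((2 * ∑ k ∈ Finset.range N, ∫ x, (y * x) ^ (2 * k) / (2 * k).factorial ∂μ : ℝ) : ℂ) := by
      induction N with
      | zero => simp
      | succ N ih =>
        have ih' := ih (sum_taylor_le_of_iteratedDeriv_nonneg hy hDan hnonneg (2 * N))
        rw [show 2 * (N + 1) = 2 * N + 1 + 1 by ring, Finset.sum_range_succ, Finset.sum_range_succ,
          ih', hodd, heven, Finset.sum_range_succ]
        have h3 : ∫ x, (y * x) ^ (2 * N) / (2 * N).factorial ∂μ =
            y ^ (2 * N) * (∫ x, x ^ (2 * N) ∂μ) / (2 * N).factorial := by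
          rw [integral_div, ← integral_const_mul]
          simp_rw [mul_pow]
        rw [h3]
        push_cast
        ring
    rw [h2] at h1
    have h3 := (Complex.le_def.1 h1).1
    rw [Complex.ofReal_re] at h3
    have h4 : (D y).re ≤ C + C := by
      refine (Complex.re_le_norm _).trans ((norm_add_le _ _).trans (add_le_add ?_ ?_))
      · rwa [mul_comm]
      · rw [show -Complex.I * (y : ℂ) = ((-y : ℝ) : ℂ) * Complex.I by push_cast; ring]
        exact hC'
    linarith
  have hcosh : ∀ x, ENNReal.ofReal (Real.cosh (y * x)) =
      ∑' k : ℕ, ENNReal.ofReal ((y * x) ^ (2 * k) / (2 * k).factorial) := by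
    intro x
    have hs := Real.hasSum_cosh (y * x)
    rw [← hs.tsum_eq, ENNReal.ofReal_tsum_of_nonneg (fun k => div_nonneg (hpos k _) (by positivity))
      hs.summable]
  simp_rw [hcosh]
  rw [lintegral_tsum fun k => by fun_prop]
  refine ENNReal.tsum_le_of_sum_range_le fun N => ?_
  have hlint : ∀ k : ℕ, ∫⁻ x, ENNReal.ofReal ((y * x) ^ (2 * k) / (2 * k).factorial) ∂μ =
      ENNReal.ofReal (∫ x, (y * x) ^ (2 * k) / (2 * k).factorial ∂μ) := by
    intro k
    rw [ofReal_integral_eq_lintegral_ofReal]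
    · simp_rw [mul_pow]
      exact ((hmom k).1.const_mul _).div_const _
    · exact Eventually.of_forall fun x => div_nonneg (hpos k _) (by positivity)
  simp_rw [hlint]
  rw [← ENNReal.ofReal_sum_of_nonneg fun k _ => integral_nonneg fun x =>
    div_nonneg (hpos k _) (by positivity)]
  exact ENNReal.ofReal_le_ofReal (hsum N)

/-! ### Extension to strips and the van Dantzig class -/

namespace VanDantzig

theorem isOpen_strip (δ : ℝ) : IsOpen {z : ℂ | |z.im| < δ} :=
  isOpen_lt (by fun_prop) continuous_const

theorem eqOn_imaginary_of_eq_real {f g : ℂ → ℂ} {δ : ℝ} (hδ : 0 < δ)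
    (hf : ∀ y : ℝ, |y| < δ → AnalyticAt ℂ f (y * Complex.I))
    (hg : ∀ y : ℝ, |y| < δ → AnalyticAt ℂ g (y * Complex.I)) (hfg : ∀ t : ℝ, f t = g t)
    {y : ℝ} (hy : |y| < δ) : f (y * Complex.I) = g (y * Complex.I) := by
  set S : Set ℂ := (fun y : ℝ => (y : ℂ) * Complex.I) '' Set.Ioo (-δ) δ with hS
  have hpre : IsPreconnected S := isPreconnected_Ioo.image _ (by fun_prop)
  have hfS : AnalyticOnNhd ℂ f S := by
    rintro _ ⟨s, hs, rfl⟩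
    exact hf s (abs_lt.2 hs)
  have hgS : AnalyticOnNhd ℂ g S := by
    rintro _ ⟨s, hs, rfl⟩
    exact hg s (abs_lt.2 hs)
  have h0 : (0 : ℂ) ∈ S := ⟨0, ⟨by linarith, hδ⟩, by simp⟩
  have hcast : Tendsto (fun t : ℝ => (t : ℂ)) (𝓝[≠] 0) (𝓝[≠] 0) := by
    refine tendsto_nhdsWithin_iff.2 ⟨?_, ?_⟩
    · exact (by simpa using Complex.continuous_ofReal.tendsto 0 :
        Tendsto (fun t : ℝ => (t : ℂ)) (𝓝 0) (𝓝 0)).mono_left nhdsWithin_le_nhds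
    · filter_upwards [self_mem_nhdsWithin] with t ht
      simpa using ht
  exact hfS.eqOn_of_preconnected_of_frequently_eq hgS hpre h0
    (hcast.frequently (Frequently.of_forall hfg)) ⟨y, abs_lt.1 hy, rfl⟩

/-- A function of `PPlus` that extends analytically to a neighbourhood of a segment of the
imaginary axis extends analytically to the corresponding strip, where it is bounded in terms of its
values on that segment. -/
theorem exists_strip_extension {F : ℝ → ℂ} (hF : F ∈ PPlus) {f : ℂ → ℂ} {δ C : ℝ} (hδ : 0 < δ)
    (hf : ∀ y : ℝ, |y| < δ → AnalyticAt ℂ f (y * Complex.I)) (hfF : ∀ t : ℝ, f t = F t)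
    (hC : ∀ y : ℝ, |y| < δ → ‖f (y * Complex.I)‖ ≤ C) :
    ∃ g : ℂ → ℂ, DifferentiableOn ℂ g {z | |z.im| < δ} ∧ (∀ z : ℂ, |z.im| < δ → ‖g z‖ ≤ 2 * C) ∧
      (∀ t : ℝ, g t = F t) ∧ ∀ y : ℝ, |y| < δ → g (y * Complex.I) = f (y * Complex.I) := by
  obtain ⟨⟨μ, hμp⟩, hμ⟩ := exists_charFun_eq_of_mem_PPlus hF
  rw [ProbabilityMeasure.coe_mk] at hμ
  have hC0 : 0 ≤ C := (norm_nonneg _).trans (hC 0 (by simpa using hδ))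
  have hexp : ∀ y : ℝ, |y| < δ →
      ∫⁻ x, ENNReal.ofReal (Real.exp (y * x)) ∂μ ≤ ENNReal.ofReal (2 * C) := by
    intro y hy
    have h1 := lintegral_cosh_le_of_charFun_analyticAt (μ := μ) (f := f) (y := |y|) (C := C)
      (abs_nonneg y) (fun s hs => hf s (hs.trans_lt hy))
      (Eventually.of_forall fun t => by rw [hμ, hfF])
      (hC _ (by rwa [abs_abs])) (hC _ (by rwa [abs_neg, abs_abs]))
    rw [ENNReal.ofReal_mul zero_le_two]
    refine le_trans ?_ (mul_le_mul_right h1 _)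
    rw [← lintegral_const_mul _ (by fun_prop)]
    refine lintegral_mono fun x => ?_
    rw [← ENNReal.ofReal_mul zero_le_two]
    refine ENNReal.ofReal_le_ofReal ?_
    have h2 : Real.cosh (|y| * x) = Real.cosh (y * x) := by
      rcases abs_choice y with h | h <;> simp [h]
    rw [h2, Real.cosh_eq]
    linarith [Real.exp_pos (-(y * x))]
  have hint : ∀ y : ℝ, |y| < δ → Integrable (fun x => Real.exp (y * x)) μ := fun y hy =>
    ⟨by fun_prop, (hasFiniteIntegral_iff_ofReal
      (Eventually.of_forall fun x => (Real.exp_pos _).le)).2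
      ((hexp y hy).trans_lt ENNReal.ofReal_lt_top)⟩
  have hinterior : ∀ y : ℝ, |y| < δ → y ∈ interior (integrableExpSet id μ) := by
    intro y hy
    refine mem_interior.2 ⟨Set.Ioo (-δ) δ, fun s hs => ?_, isOpen_Ioo, abs_lt.1 hy⟩
    exact hint s (abs_lt.2 hs)
  -- This is `z ↦ ∫ exp (i z x) dμ`, whose modulus is at most `∫ exp (-(Im z) x) dμ`. Hence the
  -- exponential moments bound it on whole horizontal lines.
  set g : ℂ → ℂ := fun z => complexMGF id μ (z * Complex.I) with hg
  have hgan : ∀ z : ℂ, |z.im| < δ → AnalyticAt ℂ g z := by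
    intro z hz
    refine AnalyticAt.fun_comp (g := complexMGF id μ) (f := fun z => z * Complex.I)
      (analyticAt_complexMGF (hinterior _ ?_)) (by fun_prop)
    simpa using hz
  have hgF : ∀ t : ℝ, g t = F t := fun t => by rw [hg, ← hμ]; exact complexMGF_id_mul_I t
  refine ⟨g, fun z hz => (hgan z hz).differentiableAt.differentiableWithinAt, fun z hz => ?_, hgF,
    fun y hy => ?_⟩
  · have hz' : |(z * Complex.I).re| < δ := by simpa using hz
    refine norm_complexMGF_le_mgf.trans ?_
    simp only [mgf, id_eq]
    rw [integral_eq_lintegral_of_nonneg_ae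
      (Eventually.of_forall fun x => (Real.exp_pos _).le) (hint _ hz').1]
    exact ENNReal.toReal_le_of_le_ofReal (by positivity) (hexp _ hz')
  · exact eqOn_imaginary_of_eq_real hδ (fun y hy => hgan _ (by simpa using hy)) hf
      (fun t => by rw [hgF, hfF]) hy

/-- The strip extensions are uniformly bounded by `2 * C`, so they form a normal family. The lemma
serves twice: for the reciprocals, then for the original functions. -/
theorem exists_strip_limit {U : Ultrafilter ℕ} {A : ℕ → ℝ → ℂ} (hA : ∀ n, A n ∈ PPlus)
    {a : ℕ → ℂ → ℂ} (haA : ∀ n, ∀ t : ℝ, a n t = A n t) {δ C : ℝ} (hδ : 0 < δ)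
    (ha : ∀ᶠ n in (U : Filter ℕ), ∀ y : ℝ, |y| < δ →
      AnalyticAt ℂ (a n) (y * Complex.I) ∧ ‖a n (y * Complex.I)‖ ≤ C) :
    ∃ g : ℂ → ℂ, DifferentiableOn ℂ g {z | |z.im| < δ} ∧
      (∀ t : ℝ, Tendsto (fun n => A n t) U (𝓝 (g t))) ∧
      (∀ ε > 0, ∃ V ∈ 𝓝 (0 : ℝ), ∀ᶠ n in (U : Filter ℕ), ∀ t ∈ V, dist (g t) (A n t) < ε) ∧
      ∀ y : ℝ, |y| < δ → Tendsto (fun n => a n (y * Complex.I)) U (𝓝 (g (y * Complex.I))) := by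
  have hex : ∀ n, ∃ g : ℂ → ℂ, (∀ y : ℝ, |y| < δ →
      AnalyticAt ℂ (a n) (y * Complex.I) ∧ ‖a n (y * Complex.I)‖ ≤ C) →
      DifferentiableOn ℂ g {z | |z.im| < δ} ∧ (∀ z : ℂ, |z.im| < δ → ‖g z‖ ≤ 2 * C) ∧
      (∀ t : ℝ, g t = A n t) ∧ ∀ y : ℝ, |y| < δ → g (y * Complex.I) = a n (y * Complex.I) := by
    intro n
    by_cases hn : ∀ y : ℝ, |y| < δ → AnalyticAt ℂ (a n) (y * Complex.I) ∧
        ‖a n (y * Complex.I)‖ ≤ C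
    · obtain ⟨g, hg⟩ := exists_strip_extension (hA n) hδ (fun y hy => (hn y hy).1) (haA n)
        fun y hy => (hn y hy).2
      exact ⟨g, fun _ => hg⟩
    · exact ⟨0, fun h => absurd h hn⟩
  choose b hb using hex
  obtain ⟨g, hg, hlim⟩ := exists_tendstoLocallyUniformlyOn_ultrafilter U (isOpen_strip δ) (f := b)
    (ha.mono fun n hn => (hb n hn).1) fun z hz => ⟨_, (isOpen_strip δ).mem_nhds hz, 2 * C,
      ha.mono fun n hn w hw => (hb n hn).2.1 w hw⟩
  have hreal : ∀ t : ℝ, (t : ℂ) ∈ {z : ℂ | |z.im| < δ} := fun t => by simpa using hδ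
  refine ⟨g, hg, fun t => ?_, fun ε hε => ?_, fun y hy => ?_⟩
  · refine (hlim.tendsto_at (hreal t)).congr' (ha.mono fun n hn => ?_)
    exact (hb n hn).2.2.1 t
  · obtain ⟨V, hV, hVn⟩ := Metric.tendstoLocallyUniformlyOn_iff.1 hlim ε hε 0
      (by simpa using hreal 0)
    rw [(isOpen_strip δ).nhdsWithin_eq (by simpa using hreal 0)] at hV
    refine ⟨(fun t : ℝ => (t : ℂ)) ⁻¹' V,
      Complex.continuous_ofReal.continuousAt.preimage_mem_nhds (by simpa using hV), ?_⟩
    filter_upwards [hVn, ha] with n hn hn' t ht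
    rw [← (hb n hn').2.2.1 t]
    exact hn t ht
  · refine (hlim.tendsto_at (by simpa using hy)).congr' (ha.mono fun n hn => ?_)
    exact (hb n hn).2.2.2 y hy

theorem _root_.MeromorphicNFAt.analyticAt_of_ne_zero {f : ℂ → ℂ} {z : ℂ} (hf : MeromorphicNFAt f z)
    (hz : f z ≠ 0) : AnalyticAt ℂ f z :=
  hf.meromorphicOrderAt_nonneg_iff_analyticAt.1 (hf.meromorphicOrderAt_eq_zero_iff.2 hz).ge

/-- If `F` and `G` in `PPlus` extend analytically to strips and `F (i y) G (y) = 1` near the origin,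
then `F` is in the van Dantzig class. -/
theorem mem_classD_of_strip {F : ℝ → ℂ} (hF : F ∈ PPlus) {h g : ℂ → ℂ} {δ ε : ℝ} (hδ : 0 < δ)
    (hε : 0 < ε) (hh : DifferentiableOn ℂ h {z | |z.im| < ε})
    (hg : DifferentiableOn ℂ g {z | |z.im| < δ}) (hhF : ∀ t : ℝ, h t = F t)
    (hgP : (fun t : ℝ => g t) ∈ PPlus)
    (hhg : ∀ y : ℝ, |y| < ε → h (y * Complex.I) * g y = 1) : F ∈ classD := by
  set k : ℂ → ℂ := fun z => g (-Complex.I * z) with hk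
  have hkan : ∀ z : ℂ, |z.re| < δ → AnalyticAt ℂ k z := by
    intro z hz
    refine AnalyticAt.fun_comp (g := g) (f := fun z => -Complex.I * z)
      (hg.analyticAt ((isOpen_strip δ).mem_nhds ?_)) (by fun_prop)
    simpa using hz
  have hhan : ∀ z : ℂ, |z.im| < ε → AnalyticAt ℂ h z := fun z hz =>
    hh.analyticAt ((isOpen_strip ε).mem_nhds hz)
  have hkI : ∀ y : ℝ, k (y * Complex.I) = g y := by
    intro y
    simp only [hk]
    congr 1
    linear_combination -(y : ℂ) * Complex.I_mul_I
  -- Since `k (iy) = g y`, the identity holds on a segment of the imaginary axis, and the identity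
  -- theorem carries it to the rectangle where both strips overlap.
  have hmul : ∀ z : ℂ, |z.re| < δ → |z.im| < ε → h z * k z = 1 := by
    set R : Set ℂ := Set.Ioo (-δ) δ ×ℂ Set.Ioo (-ε) ε with hR
    have hmem : ∀ z : ℂ, z ∈ R ↔ |z.re| < δ ∧ |z.im| < ε := fun z => by
      rw [hR, Complex.mem_reProdIm, abs_lt, abs_lt]; rfl
    have hpre : IsPreconnected R :=
      (((convex_Ioo (-δ) δ).is_linear_preimage Complex.reLm.isLinear).inter
        ((convex_Ioo (-ε) ε).is_linear_preimage Complex.imLm.isLinear)).isPreconnected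
    have han : AnalyticOnNhd ℂ (fun z => h z * k z) R := fun z hz =>
      (hhan z ((hmem z).1 hz).2).fun_mul (hkan z ((hmem z).1 hz).1)
    have h0 : (0 : ℂ) ∈ R := (hmem 0).2 (by simpa using ⟨hδ, hε⟩)
    have hcast : Tendsto (fun y : ℝ => (y : ℂ) * Complex.I) (𝓝[≠] 0) (𝓝[≠] 0) := by
      refine tendsto_nhdsWithin_iff.2 ⟨?_, ?_⟩
      · have : Continuous fun y : ℝ => (y : ℂ) * Complex.I := by fun_prop
        exact (by simpa using this.tendsto 0 :
          Tendsto (fun y : ℝ => (y : ℂ) * Complex.I) (𝓝 0) (𝓝 0)).mono_left nhdsWithin_le_nhds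
      · filter_upwards [self_mem_nhdsWithin] with t ht
        simpa using ht
    have hev : ∀ᶠ y : ℝ in 𝓝[≠] 0, h (y * Complex.I) * k (y * Complex.I) = 1 := by
      have : ∀ᶠ y : ℝ in 𝓝 0, |y| < ε :=
        (continuous_abs.tendsto 0).eventually_lt_const (by simpa using hε)
      filter_upwards [nhdsWithin_le_nhds this] with y hy
      rw [hkI, hhg y hy]
    intro z hz1 hz2
    exact han.eqOn_of_preconnected_of_frequently_eq (g := fun _ => 1) analyticOnNhd_const hpre h0
      (hcast.frequently hev.frequently) ((hmem z).2 ⟨hz1, hz2⟩)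
  -- Points of the axes with `|Im z| ≥ ε` are purely imaginary, and near them the glued function is
  -- `k⁻¹`, meromorphic in normal form with value `0` at the zeros of `k`.
  refine ⟨hF, fun z => if |z.im| < ε then h z else (k z)⁻¹, ⟨fun z hz => ?_, fun t => ?_⟩, ?_⟩
  · by_cases him : |z.im| < ε
    · have hev : (fun z : ℂ => if |z.im| < ε then h z else (k z)⁻¹) =ᶠ[𝓝 z] h := by
        filter_upwards [(isOpen_strip ε).mem_nhds him] with w hw
        exact if_pos hw
      exact (meromorphicNFAt_congr hev).2 (hhan z him).meromorphicNFAt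
    · have hre : z.re = 0 := by
        rcases hz with hz | hz
        · rw [hz, abs_zero] at him
          exact absurd hε him
        · exact hz
      have hre' : |z.re| < δ := by rwa [hre, abs_zero]
      have hopen : IsOpen {z : ℂ | |z.re| < δ} := isOpen_lt (by fun_prop) continuous_const
      have hev : (fun z : ℂ => if |z.im| < ε then h z else (k z)⁻¹) =ᶠ[𝓝 z] k⁻¹ := by
        filter_upwards [hopen.mem_nhds hre'] with w hw
        split_ifs with hw'
        · exact eq_inv_of_mul_eq_one_left (hmul w hw hw')
        · rfl
      exact (meromorphicNFAt_congr hev).2 (hkan z hre').meromorphicNFAt.inv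
  · simpa [hε] using hhF t
  · convert hgP using 1
    ext t
    simp only [reciprocal]
    split_ifs with ht
    · exact inv_eq_of_mul_eq_one_right (hhg t (by simpa using ht))
    · rw [inv_inv, hkI]

theorem classD_closed : ClosedUnderLocallyUniformConvergence classD := by
  intro F G hF hlim
  have hG : G ∈ PPlus := PPlus_of_tendstoLocallyUniformly (fun n => (hF n).1) hlim
  choose hFP f hext hrec using hF
  let U : Ultrafilter ℕ := Ultrafilter.of atTop
  have hU : (U : Filter ℕ) ≤ atTop := Ultrafilter.of_le _
  have hFlim : ∀ t, Tendsto (fun n => F n t) U (𝓝 (G t)) := fun t =>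
    ((tendstoLocallyUniformlyOn_univ.2 hlim).tendsto_at (Set.mem_univ t)).mono_left hU
  obtain ⟨δ, hδ, hhalf⟩ := exists_eventually_half_le_norm (l := atTop) hG
    fun ε hε => Metric.tendstoLocallyUniformly_iff.1 hlim ε hε 0
  have hne : ∀ {w : ℂ}, 1 / 2 ≤ ‖w‖ → w ≠ 0 := fun {w} hw h => by
    rw [h, norm_zero] at hw; norm_num at hw
  have hinv : ∀ {w : ℂ}, 1 / 2 ≤ ‖w‖ → ‖w⁻¹‖ ≤ 2 := fun {w} hw => by
    rw [norm_inv]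
    exact inv_le_of_inv_le₀ (by norm_num) (by simpa using hw)
  have hIaxes : ∀ y : ℝ, (y : ℂ) * Complex.I ∈ axes := fun y => Or.inr (by simp)
  have hRaxes : ∀ y : ℝ, (y : ℂ) ∈ axes := fun y => Or.inl (by simp)
  -- The extension `z ↦ 1 / f_n(iz)` of the reciprocal takes at `iy` the value `1 / F_n(-y)`, so the
  -- lower bound `1/2` on `[-δ, δ]` gives `C = 2`.
  obtain ⟨g, hg, hglim, hgloc, -⟩ := exists_strip_limit (U := U) (A := fun n => reciprocal (f n))
    hrec (a := fun n z => (f n (z * Complex.I))⁻¹) (fun n t => rfl) (C := 2) hδ (by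
      filter_upwards [hU hhalf] with n hn y hy
      have hI : (y : ℂ) * Complex.I * Complex.I = ((-y : ℝ) : ℂ) := by
        push_cast
        linear_combination (y : ℂ) * Complex.I_mul_I
      have hval := hn (-y) (by rw [abs_neg]; exact hy.le)
      rw [← (hext n).2] at hval
      refine ⟨?_, ?_⟩
      · refine AnalyticAt.fun_inv (AnalyticAt.fun_comp (g := f n) (f := fun z => z * Complex.I)
          ?_ (by fun_prop)) ?_
        · rw [hI]
          exact ((hext n).1 (hRaxes _)).analyticAt_of_ne_zero (hne hval)
        · rw [hI]
          exact hne hval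
      · rw [hI]
        exact hinv hval)
  have hgP : (fun t : ℝ => g t) ∈ PPlus := by
    refine PPlus_of_tendsto hrec hglim ?_ ⟨1, fun t => le_of_tendsto (hglim t).norm
      (Eventually.of_forall fun n => PPlus_norm_le_one (hrec n) t)⟩
    exact hg.continuousOn.comp_continuous Complex.continuous_ofReal fun t => by simpa using hδ
  obtain ⟨ε, hε, hhalf'⟩ := exists_eventually_half_le_norm hgP hgloc
  -- Roles exchanged: `f_n(iy)` is the inverse of the reciprocal at `y`. A nonzero reciprocal means
  -- `f_n(iy) ≠ 0`, which rules out a pole because normal form takes the value `0` at poles.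
  obtain ⟨h, hh, hhlim, -, hhI⟩ := exists_strip_limit (U := U) hFP (a := f) (fun n => (hext n).2)
    (C := 2) hε (by
      filter_upwards [hhalf'] with n hn y hy
      have hval := hn y hy.le
      refine ⟨((hext n).1 (hIaxes y)).analyticAt_of_ne_zero fun h0 => hne hval ?_, ?_⟩
      · simp [reciprocal, h0]
      · simpa [reciprocal] using hinv hval)
  refine mem_classD_of_strip hG hδ hε hh hg (fun t => tendsto_nhds_unique (hhlim t) (hFlim t)) hgP
    fun y hy => ?_
  refine tendsto_nhds_unique ((hhI y hy).mul (hglim y)) (tendsto_const_nhds.congr' ?_)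
  filter_upwards [hhalf'] with n hn
  have hval := hne (hn y hy.le)
  rw [reciprocal, ne_eq, inv_eq_zero] at hval
  exact (mul_inv_cancel₀ hval).symm

end VanDantzig

theorem mainTheorem4 :
    VanDantzig.ClosedUnderLocallyUniformConvergence VanDantzig.classD ∧
      VanDantzig.ClosedUnderLocallyUniformConvergence VanDantzig.classDL :=
  ⟨VanDantzig.classD_closed, VanDantzig.classDL_closed⟩
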